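/- **Logic.** For $\ell\ge 0$ consider first-order formulas with equality over the signature consisting of a binary edge symbol $G$, a unary predicate $ReqNode$ and a relation symbol $T$ of arity $\ell+1$. For a formula $\varphi(T)(x,y_1,\dots,y_\ell)$ and $k\ge 0$, let $\varphi^{(k)}(T)(x,y_1,\dots,y_\ell)$ be the formula obtained from $\varphi$ by replacing each quantifier $\forall z$, $\exists z$ by $\forall z\in\mathcal N^k(x)$, $\exists z\in\mathcal N^k(x)$ and by adding the conjunct $y_i\in\mathcal N^k(x)$ for every $i$, where $z\in\mathcal N^k(x)$ abbreviates the first-order formula stating that the distance between $x$ and $z$ in the graph is at most $k$. The local fixpoint fragment $FP_{loc}$ consists of the formulas $\mu(\varphi^{(k)}(T)(x,\vec y))$; on a finite graph with a distinguished node satisfying $ReqNode$, such a formula defines the inflationary fixpoint $I=\bigcup_i I_i$, where $I_0=\emptyset$ and $I_{i+1}=\varphi^{(k)}(I_i)\cup I_i$. **Model.** A network is a finite connected undirected simple graph of maximum degree at most $D$ whose nodes have unique identifiers and arbitrarily numbered ports in $\{1,\dots,D\}$, one for each neighbor. All nodes run the same program, a multi-tape Turing machine with one in-buffer and one out-buffer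 (words of bits) per port; initially a node has on its tape its identifier, the number $n$ of nodes, the diameter $\Delta$ and the identifiers of its neighbors, and it sees which ports are linked. The system is synchronous and free of failures: in every round each active node computes until its program ends the round, and then the words in the out-buffers are delivered to the neighbors. Initially all buffers are empty and only the requesting node (the one satisfying $ReqNode$) is active; any other node becomes active when it receives its first message. The evaluation has terminated when all out-buffers stay empty and no stored answer changes any more. The program evaluates $\mu(\psi(T)(x,\vec y))$ if upon termination every node $a$ stores exactly the tuples $(a,b_1,\dots,b_\ell)$ of the fixpoint $I$ whose first component is $a$, each $b_i$ being given by a local name, that is, the sequence of outgoing ports along some walk from $a$ to $b_i$. **Theorem.** For every $D$ and every formula $\mu(\varphi^{(k)}(T)(x,\vec y))$ of $FP_{loc}$ there are a program and a constant $C$ (depending only on $D$ and the formula) such that on every network of degree at most $D$, with any number $n$ of nodes and any requesting node, the program evaluates the formula, and * every node makes at most $C$ computation steps in each round (IN-TIME/ROUND $=O(1)$); * every message has at most $C$ bits (MSG-SIZE $=O(1)$); * every node sends at most $C$ messages in total ($\#$MSG/NODE $=O(1)$); * the evaluation terminates within $C\cdot n$ rounds (DIST-TIME $=O(n)$). -/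

import Mathlib

namespace DistFP

open FirstOrder FirstOrder.Language

/-! ### Fixpoint logic on graphs -/

/-- Relation symbols: the edge relation `G`, the predicate `ReqNode` of the requesting node, and the
fixpoint relation `T` of arity `ℓ + 1`. -/
inductive RelSym (ℓ : ℕ) : ℕ → Type
  | G : RelSym ℓ 2
  | reqNode : RelSym ℓ 1
  | T : RelSym ℓ (ℓ + 1)

/-- The relational language `{G, ReqNode, T}` (with equality). -/
def lang (ℓ : ℕ) : FirstOrder.Language := ⟨fun _ => Empty, RelSym ℓ⟩

/-- First-order formulas with bound variables in `Fin m` and free variables `x, y₁, …, y_ℓ`; the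
free variable `0 : Fin (ℓ + 1)` is `x`. -/
abbrev BForm (ℓ m : ℕ) : Type := (lang ℓ).BoundedFormula (Fin (ℓ + 1)) m

/-- First-order formulas with free variables `x, y₁, …, y_ℓ`. -/
abbrev Form (ℓ : ℕ) : Type := (lang ℓ).Formula (Fin (ℓ + 1))

/-- The structure on the node set given by the graph, the requesting node `r` and an
interpretation `I` of `T`. -/
@[reducible] def interp {V : Type} {ℓ : ℕ} (G : SimpleGraph V) (r : V) (I : Set (Fin (ℓ + 1) → V)) :
    (lang ℓ).Structure V where
  funMap := fun f => Empty.elim f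
  RelMap := fun {_} R =>
    match R with
    | RelSym.G => fun x => G.Adj (x 0) (x 1)
    | RelSym.reqNode => fun x => x 0 = r
    | RelSym.T => fun x => x ∈ I

/-- Satisfaction of a formula with `T` interpreted by `I`. -/
def Sat {V : Type} {ℓ : ℕ} (G : SimpleGraph V) (r : V) (I : Set (Fin (ℓ + 1) → V))
    (φ : Form ℓ) (a : Fin (ℓ + 1) → V) : Prop :=
  letI := interp G r I
  φ.Realize a

/-- The stages `I₀ = ∅`, `I_{i+1} = φ(I_i) ∪ I_i`. -/
def stage {V : Type} {ℓ : ℕ} (G : SimpleGraph V) (r : V) (φ : Form ℓ) :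
    ℕ → Set (Fin (ℓ + 1) → V)
  | 0 => ∅
  | i + 1 => {a | Sat G r (stage G r φ i) φ a} ∪ stage G r φ i

/-- The inflationary fixpoint `μ(φ(T))`: the union of its (increasing) stages. -/
def fixpoint {V : Type} {ℓ : ℕ} (G : SimpleGraph V) (r : V) (φ : Form ℓ) :
    Set (Fin (ℓ + 1) → V) :=
  ⋃ i, stage G r φ i

/-- The first-order formula `dist(u, w) ≤ k` in the two free variables `u = 0`, `w = 1`:
`dist(u, w) ≤ k + 1` iff `∃ z, dist(u, z) ≤ k ∧ (z = w ∨ G(z, w))`. -/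
def distLE (ℓ : ℕ) : ℕ → (lang ℓ).Formula (Fin 2)
  | 0 => Term.equal (Term.var 0) (Term.var 1)
  | k + 1 =>
    let near : (lang ℓ).BoundedFormula (Fin 2) 1 :=
      BoundedFormula.relabel (n := 1) (k := 0) ![Sum.inl 0, Sum.inr 0] (distLE ℓ k)
    let z : (lang ℓ).Term (Fin 2 ⊕ Fin 1) := Term.var (Sum.inr 0)
    let w : (lang ℓ).Term (Fin 2 ⊕ Fin 1) := Term.var (Sum.inl 1)
    let adj : (lang ℓ).BoundedFormula (Fin 2) 1 :=
      BoundedFormula.rel (l := 2) (RelSym.G : RelSym ℓ 2) ![z, w]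
    (near ⊓ (Term.bdEqual z w ⊔ adj)).ex

/-- Every quantifier `∀ z` is replaced by `∀ z ∈ N^k(x)`, i.e. `∀ z, dist(x, z) ≤ k → …`
(`∃` is `¬ ∀ ¬`, so it becomes `∃ z ∈ N^k(x)`). -/
def relativize {ℓ : ℕ} (k : ℕ) : {m : ℕ} → BForm ℓ m → BForm ℓ m
  | _, .falsum => .falsum
  | _, .equal s t => .equal s t
  | _, .rel R ts => .rel R ts
  | _, .imp φ ψ => .imp (relativize k φ) (relativize k ψ)
  | m, .all φ =>
    let near : BForm ℓ (m + 1) :=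
      BoundedFormula.relabel (n := m + 1) (k := 0) ![Sum.inl 0, Sum.inr (Fin.last m)] (distLE ℓ k)
    .all (near.imp (relativize k φ))

/-- The formula `φ^{(k)}(x, y₁, …, y_ℓ)`: quantifiers relativized to `N^k(x)`, together with
`y_i ∈ N^k(x)` for all `i`. -/
noncomputable def localize {ℓ : ℕ} (k : ℕ) (φ : Form ℓ) : Form ℓ :=
  relativize k φ ⊓
    BoundedFormula.iInf fun i : Fin ℓ =>
      (BoundedFormula.relabel (n := 0) (k := 0) ![Sum.inl 0, Sum.inl i.succ] (distLE ℓ k) :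
        BForm ℓ 0)

/-- `μ(ψ(T)(x, y₁, …, y_ℓ))` belongs to the local fragment of fixpoint logic. -/
def IsFPLoc {ℓ : ℕ} (ψ : Form ℓ) : Prop :=
  ∃ (k : ℕ) (φ : Form ℓ), ψ = localize k φ

/-! ### Networks -/

/-- A finite connected undirected network of degree at most `D` with ports and unique
identifiers.  `port v p = some (w, q)` says that port `p` of `v` and port `q` of `w` are the two
ends of the link between `v` and `w`; the port numbering is arbitrary at each node. -/
structure Network (D : ℕ) (V : Type) where
  graph : SimpleGraph V
  connected : graph.Connected
  port : V → Fin D → Option (V × Fin D)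
  port_symm : ∀ v p w q, port v p = some (w, q) → port w q = some (v, p)
  adj_iff : ∀ v w, graph.Adj v w ↔ ∃ p q, port v p = some (w, q)
  port_unique : ∀ v w p q p' q', port v p = some (w, q) → port v p' = some (w, q') → p = p'
  ident : V → ℕ
  ident_injective : Function.Injective ident

/-- The node reached from `v` along a trace of outgoing ports (if all these ports are linked). -/
def Network.follow {D : ℕ} {V : Type} (N : Network D V) : V → List (Fin D) → Option V
  | v, [] => some v
  | v, p :: ps => (N.port v p).bind fun e => N.follow e.1 ps

/-! ### Node machines

Every node runs a copy of one multi-tape Turing machine, with one in-buffer and one out-buffer of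
bits for each port, and a local table for the answers. -/

/-- Tape symbols. -/
inductive Sym
  | blank
  | sep
  | bit (b : Bool)

instance : Inhabited Sym := ⟨Sym.blank⟩

/-- What the machine sees at a port: no link, no (further) incoming bit, or the next bit of the
incoming message. -/
inductive PortView
  | unlinked
  | empty
  | bit (b : Bool)

/-- One elementary step of a machine with control states `Q` and `s` tapes. -/
structure Action (D ℓ : ℕ) (Q : Type) (s : ℕ) where
  /-- next control state -/
  next : Q
  /-- symbol written on each tape -/
  write : Fin s → Sym
  /-- move of each head (`none`: the head stays) -/
  move : Fin s → Option Turing.Dir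
  /-- whether the first remaining bit of each in-buffer is consumed -/
  consume : Fin D → Bool
  /-- bit appended to each out-buffer, if any -/
  send : Fin D → Option Bool
  /-- tuple inserted in the local table, if any: `ℓ` local names, that is, traces of ports -/
  store : Option (Fin ℓ → List (Fin D))
  /-- whether this step ends the computation of the current round -/
  halt : Bool

/-- A node program: finitely many control states, tapes `0, …, extra`, an initial state for the
requesting node and one for the other nodes, and a transition table. -/
structure Machine (D ℓ : ℕ) where
  Q : Type
  finite_Q : Finite Q
  extra : ℕ
  startReq : Q
  start : Q
  trans : Q → (Fin (extra + 1) → Sym) → (Fin D → PortView) → Action D ℓ Q (extra + 1)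

/-- Configuration of one node.  An empty buffer at a port means that there is no message. -/
structure Config {D ℓ : ℕ} (M : Machine D ℓ) where
  /-- the engine of this node has been started -/
  awake : Prop
  state : M.Q
  tape : Fin (M.extra + 1) → Turing.Tape Sym
  inBuf : Fin D → List Bool
  outBuf : Fin D → List Bool
  table : Set (Fin ℓ → List (Fin D))

section Step

variable {D ℓ : ℕ} {V : Type} (N : Network D V) {M : Machine D ℓ}

/-- The view of port `p` at node `v`. -/
def portView (v : V) (c : Config M) (p : Fin D) : PortView :=
  match N.port v p, c.inBuf p with
  | none, _ => .unlinked
  | some _, [] => .empty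
  | some _, b :: _ => .bit b

/-- The transition that applies in a configuration of node `v`. -/
def action (v : V) (c : Config M) : Action D ℓ M.Q (M.extra + 1) :=
  M.trans c.state (fun i => (c.tape i).head) (portView N v c)

/-- The effect of one elementary step at node `v` (nothing is sent at unlinked ports). -/
def step (v : V) (c : Config M) : Config M where
  awake := c.awake
  state := (action N v c).next
  tape := fun i =>
    let t := (c.tape i).write ((action N v c).write i)
    match (action N v c).move i with
    | none => t
    | some d => t.move d
  inBuf := fun p => if (action N v c).consume p then (c.inBuf p).tail else c.inBuf p
  outBuf := fun p =>
    match N.port v p, (action N v c).send p with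
    | some _, some b => c.outBuf p ++ [b]
    | _, _ => c.outBuf p
  table :=
    match (action N v c).store with
    | none => c.table
    | some e => insert e c.table

/-- `Runs N v c s c'`: started in `c`, the computation of node `v` in the current round ends in
`c'` after exactly `s` elementary steps. -/
inductive Runs (v : V) : Config M → ℕ → Config M → Prop
  | last (c : Config M) : (action N v c).halt = true → Runs v c 1 (step N v c)
  | more (c : Config M) (s : ℕ) (c' : Config M) : (action N v c).halt = false →
      Runs v (step N v c) s c' → Runs v c (s + 1) c'

/-- The node computes in this round: it is already awake, or some incoming message wakes it up. -/
def Config.Active (c : Config M) : Prop := c.awake ∨ ∃ p, c.inBuf p ≠ []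

/-- The computation event of one round at node `v`, with its number of steps. An idle node that has
never received a message does nothing. -/
def Computes (v : V) (c : Config M) (s : ℕ) (c' : Config M) : Prop :=
  (c.Active ∧ Runs N v { c with awake := True } s c') ∨ (¬ c.Active ∧ s = 0 ∧ c' = c)

/-- The delivery event at node `v`, given the configurations of all nodes after computation. -/
def deliver (c : V → Config M) (v : V) : Config M :=
  { c v with
    inBuf := fun p =>
      match N.port v p with
      | none => []
      | some (w, q) => (c w).outBuf q
    outBuf := fun _ => [] }

end Step

/-- A number in binary, followed by a separator. -/
def numWord (m : ℕ) : List Sym := m.bits.map Sym.bit ++ [Sym.sep]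

/-- The metadata of a node: its identifier, the number of nodes, the diameter, and the identifiers
of its neighbors, port by port. -/
noncomputable def metadata {D : ℕ} {V : Type} (N : Network D V) (v : V) : List Sym :=
  numWord (N.ident v) ++ numWord (Nat.card V) ++ numWord N.graph.diam ++
    (List.finRange D).flatMap fun p =>
      match N.port v p with
      | none => [Sym.sep]
      | some (w, _) => numWord (N.ident w)

open Classical in
/-- Initial configuration of node `v` when `r` is the requesting node: tape `0` holds the metadata,
everything else is empty, and only `r` is awake. -/
noncomputable def initial {D ℓ : ℕ} {V : Type} (N : Network D V) (M : Machine D ℓ) (r v : V) :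
    Config M where
  awake := v = r
  state := if v = r then M.startReq else M.start
  tape := fun i => if i = 0 then Turing.Tape.mk₁ (metadata N v) else default
  inBuf := fun _ => []
  outBuf := fun _ => []
  table := ∅

/-- A synchronous execution on the network `N` with requesting node `r`.  In round `t` node `v`
computes from `pre t v` to `post t v` in `time t v` steps; then all messages are delivered.
(As machines are deterministic, there is at most one execution; there is none if some
computation event does not end.) -/
structure Execution {D ℓ : ℕ} {V : Type} (N : Network D V) (M : Machine D ℓ) (r : V) where
  pre : ℕ → V → Config M
  post : ℕ → V → Config M
  time : ℕ → V → ℕ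
  pre_zero : ∀ v, pre 0 v = initial N M r v
  computes : ∀ t v, Computes N v (pre t v) (time t v) (post t v)
  pre_succ : ∀ t v, pre (t + 1) v = deliver N (post t) v

section Execution

variable {D ℓ : ℕ} {V : Type} {N : Network D V} {M : Machine D ℓ} {r : V}

/-- Number of messages sent by node `v` in round `t`. -/
def Execution.numSent (E : Execution N M r) (t : ℕ) (v : V) : ℕ :=
  (Finset.univ.filter fun p : Fin D => (E.post t v).outBuf p ≠ []).card

/-- Termination within `τ` rounds: from then on all out-buffers stay empty and no local
table changes. -/
def Execution.TerminatedBy (E : Execution N M r) (τ : ℕ) : Prop :=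
  ∀ t, τ ≤ t → ∀ v, (∀ p, (E.post t v).outBuf p = []) ∧ (E.post t v).table = (E.pre t v).table

/-- The local table of node `v` in configuration `c` represents exactly the tuples `(v, b₁, …, b_ℓ)`
of the relation `I` with first component `v`. -/
def Holds (N : Network D V) (I : Set (Fin (ℓ + 1) → V)) (v : V) (c : Config M) : Prop :=
  (∀ e ∈ c.table, ∃ b : Fin ℓ → V, (∀ i, N.follow v (e i) = some (b i)) ∧
      (Fin.cons v b : Fin (ℓ + 1) → V) ∈ I) ∧
  (∀ b : Fin ℓ → V, (Fin.cons v b : Fin (ℓ + 1) → V) ∈ I →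
      ∃ e ∈ c.table, ∀ i, N.follow v (e i) = some (b i))

end Execution

end DistFP

namespace DistFP

open FirstOrder FirstOrder.Language

/-! ### Message-frugal automata -/

/-! Identifiers and the numbers `n`, `Δ` are never read: each node is a finite automaton whose size
depends only on `D` and the formula. Three things make this possible.

Few messages. A node exposes a value at each port, and the machine transmits it only when it
changes, the receiver remembering the last value (`Automaton.exists_execution`). In the evaluation
automaton all exposed data evolve monotonically through a finite set, so a bounded measure grows at
every exposed change (`measure_succ`); this bounds the messages of each node.

Local names. A depth-first traversal from the requesting node visits the nodes one at a time in
linearly many rounds (`StackInv.succ`, `exists_done`). A visited node waits until the colors used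
within distance `3k + 1` have reached it and takes another one; bounded degree guarantees a free
color (`pickColor_spec`), and since two nodes never wait simultaneously, close nodes get distinct
colors (`col_ne`). Facts are stored as atoms about colors that travel at most `3k + 1` edges. On the
`k`-ball of a node the coloring is then an embedding, so a local formula can be evaluated on its
image (`satIn_image_iff`, `Colored.eval_iff`).

Synchronization. When the traversal ends, the requesting node floods a start signal, which reaches
`v` after `dist r v` further rounds; from then on `v` evaluates the formula once every `2k + 1`
rounds of a private cyclic clock. The clocks of nodes at distance `d ≤ k` differ by at most `d`, and
facts need `d` rounds to travel, so with this period every node sees exactly the preceding stage,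
neither less nor more (`Colored.rel_mem_iff`). The clock is not exposed, hence ticks for free.

Linear time. A tuple of a stage is determined by its first entry and the colors of the others, so
the fixpoint has `O(n)` tuples and is reached after `O(n)` stages of constant length
(`Colored.ncard_stage_le`, `stage_eq_fixpoint`). -/

/-- A finite-state node automaton.  At every port a node exposes a value `out s p`; in each round it
updates its state from the values exposed by its neighbors (`none` at unlinked ports), and stores
the tuples `tab s` of its state. -/
structure Automaton (D ℓ : ℕ) where
  S : Type
  Msg : Type
  finite_S : Finite S
  finite_Msg : Finite Msg
  startReq : S
  start : S
  quiet : Msg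
  out : S → Fin D → Msg
  next : S → (Fin D → Option Msg) → S
  tab : S → Set (Fin ℓ → List (Fin D))
  finite_tab : ∀ s, (tab s).Finite
  out_startReq : ∀ p, out startReq p = quiet
  out_start : ∀ p, out start p = quiet
  tab_startReq : tab startReq = ∅
  tab_start : tab start = ∅
  next_start : ∀ m : Fin D → Option Msg, (∀ p x, m p = some x → x = quiet) → next start m = start

namespace Automaton

variable {D ℓ : ℕ} {V : Type}

/-- The values that node `v` sees at its ports when the nodes are in the states `x`. -/
def view (A : Automaton D ℓ) (N : Network D V) (x : V → A.S) (v : V) (p : Fin D) : Option A.Msg :=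
  (N.port v p).map fun e => A.out (x e.1) e.2

open Classical in
/-- The synchronous run of an automaton with requesting node `r`. -/
noncomputable def run (A : Automaton D ℓ) (N : Network D V) (r : V) : ℕ → V → A.S
  | 0 => fun v => if v = r then A.startReq else A.start
  | t + 1 => fun v => A.next (run A N r t v) (A.view N (run A N r t) v)

variable (A : Automaton D ℓ)

instance : Finite A.S := A.finite_S
instance : Finite A.Msg := A.finite_Msg

/-- The list of the tuples stored in a state. -/
noncomputable def tabList (s : A.S) : List (Fin ℓ → List (Fin D)) := (A.finite_tab s).toFinset.toList

lemma mem_tabList (s : A.S) (e : Fin ℓ → List (Fin D)) : e ∈ A.tabList s ↔ e ∈ A.tab s := by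
  simp [tabList]

/-! ### Unary coding of messages -/

/-- A numbering of the messages. -/
noncomputable def code : A.Msg ≃ Fin (Nat.card A.Msg) := Finite.equivFin A.Msg

/-- A single bound serves both for the lengths of unary words and for the number of tuples stored
one per step, so that both phases of a round can have the same fixed length. -/
lemma exists_width : ∃ W, Nat.card A.Msg ≤ W ∧ ∀ s, (A.tabList s).length ≤ W := by
  obtain ⟨B, hB⟩ := (Set.finite_range fun s => (A.tabList s).length).bddAbove
  exact ⟨max (Nat.card A.Msg) B, le_max_left _ _,
    fun s => (hB (Set.mem_range_self s)).trans (le_max_right _ _)⟩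

/-- The number of steps of the reading phase and of the writing phase of a round. -/
noncomputable def width : ℕ := A.exists_width.choose

lemma card_le_width : Nat.card A.Msg ≤ A.width := A.exists_width.choose_spec.1

lemma length_tabList_le (s : A.S) : (A.tabList s).length ≤ A.width := A.exists_width.choose_spec.2 s

/-- The length of the unary code of a message. -/
noncomputable def len (m : A.Msg) : ℕ := (A.code m : ℕ) + 1

lemma len_le (m : A.Msg) : A.len m ≤ A.width := (A.code m).2.trans_le A.card_le_width

lemma len_pos (m : A.Msg) : A.len m ≠ 0 := Nat.succ_ne_zero _

open Classical in
/-- The message with a given length, or a fallback value. -/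
noncomputable def decode (fallback : A.Msg) (c : ℕ) : A.Msg :=
  if h : ∃ m, A.len m = c then h.choose else fallback

lemma decode_len (f m : A.Msg) : A.decode f (A.len m) = m := by
  have h : ∃ m', A.len m' = A.len m := ⟨m, rfl⟩
  rw [decode, dif_pos h]
  exact A.code.injective (Fin.ext (Nat.succ_injective h.choose_spec))

/-- Code words have positive length, which leaves the empty buffer free to mean "unchanged": the
remembered value is used as fallback. -/
lemma decode_zero (f : A.Msg) : A.decode f 0 = f := by
  rw [decode, dif_neg]
  rintro ⟨m, hm⟩
  exact A.len_pos m hm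

/-- Control states of the machine: reading the incoming words bit by bit, then writing. -/
inductive Control
  | read (i : Fin (A.width + 1)) (s : A.S) (mem : Fin D → A.Msg) (cnt : Fin D → Fin (A.width + 1))
  | write (i : Fin (A.width + 1)) (s s' : A.S) (mem : Fin D → A.Msg)

instance : Finite A.Control := by
  let f : (Fin (A.width + 1) × A.S × (Fin D → A.Msg) × (Fin D → Fin (A.width + 1))) ⊕
      (Fin (A.width + 1) × A.S × A.S × (Fin D → A.Msg)) → A.Control :=
    Sum.elim (fun x => .read x.1 x.2.1 x.2.2.1 x.2.2.2) (fun x => .write x.1 x.2.1 x.2.2.1 x.2.2.2)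
  refine Finite.of_surjective f ?_
  rintro (⟨i, s, m, c⟩ | ⟨i, s, s', m⟩)
  · exact ⟨Sum.inl ⟨i, s, m, c⟩, rfl⟩
  · exact ⟨Sum.inr ⟨i, s, s', m⟩, rfl⟩

/-- The unary counter of a port after one more reading step. -/
def bump {W : ℕ} (c : Fin (W + 1)) : PortView → Fin (W + 1)
  | .bit _ => ⟨min (c + 1) W, by omega⟩
  | _ => c

/-- What the automaton sees at a port, given the remembered value. -/
def seen {α : Type} (m : α) : PortView → Option α
  | .unlinked => none
  | _ => some m

open Classical in
/-- The length of the word sent at port `p` when the state changes from `s` to `s'`. -/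
noncomputable def sendLen (s s' : A.S) (p : Fin D) : ℕ :=
  if A.out s p = A.out s' p then 0 else A.len (A.out s' p)

lemma sendLen_le (s s' : A.S) (p : Fin D) : A.sendLen s s' p ≤ A.width := by
  unfold sendLen; split_ifs
  · exact Nat.zero_le _
  · exact A.len_le _

/-- The transition table of the machine. -/
noncomputable def trans : A.Control → (Fin 1 → Sym) → (Fin D → PortView) → Action D ℓ A.Control 1
  | .read i s mem cnt, sym, pv =>
    { next := if h : (i : ℕ) < A.width then .read ⟨i + 1, by omega⟩ s mem fun p => bump (cnt p) (pv p)
        else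
          .write 0 s (A.next s fun p => seen (A.decode (mem p) (cnt p)) (pv p))
            fun p => A.decode (mem p) (cnt p)
      write := sym
      move := fun _ => none
      consume := fun _ => true
      send := fun _ => none
      store := none
      halt := false }
  | .write i s s' mem, sym, _ =>
    { next := if h : (i : ℕ) < A.width then .write ⟨i + 1, by omega⟩ s s' mem
        else .read 0 s' mem fun _ => 0
      write := sym
      move := fun _ => none
      consume := fun _ => false
      send := fun p => if (i : ℕ) < A.sendLen s s' p then some true else none
      store := (A.tabList s')[(i : ℕ)]?
      halt := decide ((i : ℕ) = A.width) }

/-- The machine that runs the automaton and sends only what has changed. -/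
noncomputable def machine : Machine D ℓ where
  Q := A.Control
  finite_Q := inferInstance
  extra := 0
  startReq := .read 0 A.startReq (fun _ => A.quiet) fun _ => 0
  start := .read 0 A.start (fun _ => A.quiet) fun _ => 0
  trans := A.trans

/-! ### One round of the machine -/

variable {A} (N : Network D V)

/-- Induction on the number `j` of steps left. Step `i` sends bit `i` of each unary word and stores
entry `i` of the list of tuples, so what remains are the positions from `i` on. -/
lemma runs_write {v : V} {s s' : A.S} {mem : Fin D → A.Msg} (j : ℕ) :
    ∀ (i : Fin (A.width + 1)) (c : Config A.machine), (i : ℕ) + j = A.width →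
      c.state = Control.write i s s' mem →
      ∃ c', Runs N v c (j + 1) c' ∧ c'.state = Control.read 0 s' mem (fun _ => 0) ∧
        c'.awake = c.awake ∧
        (∀ p, c'.outBuf p = c.outBuf p ++
          if N.port v p = none then [] else List.replicate (A.sendLen s s' p - i) true) ∧
        c'.table = c.table ∪ {e | ∃ m, (i : ℕ) ≤ m ∧ (A.tabList s')[m]? = some e} := by
  induction j with
  | zero =>
    intro i c hi hc
    have ha : action N v c = A.trans (.write i s s' mem) (fun i => (c.tape i).head)
        (portView N v c) := by
      unfold action; rw [hc]; rfl
    refine ⟨_, Runs.last c ?_, ?_, rfl, ?_, ?_⟩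
    · rw [ha]; simpa [trans] using hi
    · simp only [step, ha, trans]
      rw [dif_neg (by omega)]
    · intro p
      have h1 : ¬ ((i : ℕ) < A.sendLen s s' p) := by have := A.sendLen_le s s' p; omega
      have h2 : A.sendLen s s' p - i = 0 := by omega
      simp only [step, ha, trans, h1, h2]
      cases N.port v p <;> simp
    · have h3 : ∀ m, (i : ℕ) ≤ m → (A.tabList s')[m]? = none := by
        intro m hm
        rw [List.getElem?_eq_none_iff]
        have := A.length_tabList_le s'; omega
      simp only [step, ha, trans, h3 i le_rfl]
      ext e
      simp only [Set.mem_union, Set.mem_ofPred_eq]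
      constructor
      · exact Or.inl
      · rintro (h | ⟨m, hm, h⟩)
        · exact h
        · simp [h3 m hm] at h
  | succ j ih =>
    intro i c hi hc
    have ha : action N v c = A.trans (.write i s s' mem) (fun i => (c.tape i).head)
        (portView N v c) := by
      unfold action; rw [hc]; rfl
    have hlt : (i : ℕ) < A.width := by omega
    obtain ⟨c', hr, hs, haw, hout, htab⟩ := ih ⟨i + 1, by omega⟩ (step N v c) (by simp; omega)
      (by simp only [step, ha, trans]; rw [dif_pos hlt])
    refine ⟨c', Runs.more c _ _ ?_ hr, hs, haw, ?_, ?_⟩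
    · rw [ha]; simp [trans]; omega
    · intro p
      rw [hout]
      simp only [step, ha, trans]
      rcases hp : N.port v p with _ | e
      · simp
      · simp only [reduceCtorEq, if_false]
        split_ifs with h
        · have : A.sendLen s s' p - i = (A.sendLen s s' p - (i + 1)) + 1 := by omega
          rw [this, List.replicate_succ]
          simp
        · have h1 : A.sendLen s s' p - i = 0 := by omega
          have h2 : A.sendLen s s' p - (i + 1) = 0 := by omega
          simp [h1, h2]
    · rw [htab]
      simp only [step, ha, trans]
      ext e
      rcases h : (A.tabList s')[(i : ℕ)]? with _ | e'
      · simp only [Set.mem_union, Set.mem_ofPred_eq]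
        refine or_congr_right ⟨fun ⟨m, hm, h'⟩ => ⟨m, by omega, h'⟩, fun ⟨m, hm, h'⟩ => ⟨m, ?_, h'⟩⟩
        rcases hm.eq_or_lt with rfl | h3
        · simp [h] at h'
        · omega
      · simp only [Set.mem_union, Set.mem_ofPred_eq, Set.mem_insert_iff]
        constructor
        · rintro ((rfl | h1) | ⟨m, hm, h'⟩)
          · exact Or.inr ⟨i, le_rfl, h⟩
          · exact Or.inl h1
          · exact Or.inr ⟨m, by omega, h'⟩
        · rintro (h1 | ⟨m, hm, h'⟩)
          · exact Or.inl (Or.inr h1)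
          · rcases hm.eq_or_lt with rfl | h3
            · rw [h] at h'; exact Or.inl (Or.inl (Option.some.inj h').symm)
            · exact Or.inr ⟨m, by omega, h'⟩

/-- Induction on the number `j` of reading steps left: after `i` steps the counter of a port is `min
i (n p)` and `i` bits have been consumed. The base case decodes the counters and hands over to
`runs_write`. -/
lemma runs_read {v : V} {s : A.S} {mem : Fin D → A.Msg} {n : Fin D → ℕ} (hn : ∀ p, n p ≤ A.width)
    (hn0 : ∀ p, N.port v p = none → n p = 0) (j : ℕ) :
    ∀ (i : Fin (A.width + 1)) (cnt : Fin D → Fin (A.width + 1)) (c : Config A.machine),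
      (i : ℕ) + j = A.width → c.state = Control.read i s mem cnt →
      (∀ p, (cnt p : ℕ) = min (i : ℕ) (n p)) → (∀ p, c.inBuf p = List.replicate (n p - i) true) →
      (∀ p, c.outBuf p = []) →
      ∃ c' s', Runs N v c (j + 1 + (A.width + 1)) c' ∧
        s' = A.next s (fun p => (N.port v p).map fun _ => A.decode (mem p) (n p)) ∧
        c'.state = Control.read 0 s' (fun p => A.decode (mem p) (n p)) (fun _ => 0) ∧
        c'.awake = c.awake ∧
        (∀ p, c'.outBuf p =
          if N.port v p = none then [] else List.replicate (A.sendLen s s' p) true) ∧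
        c'.table = c.table ∪ A.tab s' := by
  induction j with
  | zero =>
    intro i cnt c hi hc hcnt hin hout
    have ha : action N v c = A.trans (.read i s mem cnt) (fun i => (c.tape i).head)
        (portView N v c) := by
      unfold action; rw [hc]; rfl
    have hcnt' : ∀ p, (cnt p : ℕ) = n p := fun p => by rw [hcnt, min_eq_right]; have := hn p; omega
    have hst : (step N v c).state = Control.write 0 s
        (A.next s (fun p => (N.port v p).map fun _ => A.decode (mem p) (n p)))
        (fun p => A.decode (mem p) (n p)) := by
      simp only [step, ha, trans]
      rw [dif_neg (by omega)]
      simp only [hcnt']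
      congr 2
      funext p
      unfold portView
      rcases N.port v p with _ | e
      · simp [seen]
      · rcases c.inBuf p with _ | ⟨b, l⟩ <;> simp [seen]
    obtain ⟨c', hr, hs, haw, ho, htab⟩ := runs_write N A.width 0 (step N v c) (by simp) hst
    refine ⟨c', _, ?_, rfl, hs, haw, ?_, ?_⟩
    · rw [zero_add, add_comm 1]
      exact Runs.more c _ _ (by rw [ha]; rfl) hr
    · intro p
      have : (step N v c).outBuf p = [] := by
        simp only [step, ha, trans, hout]; cases N.port v p <;> rfl
      rw [ho, this]
      simp
    · rw [htab]
      have : (step N v c).table = c.table := by simp only [step, ha, trans]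
      rw [this]
      congr 1
      ext e
      simp [← List.mem_iff_getElem?, mem_tabList]
  | succ j ih =>
    intro i cnt c hi hc hcnt hin hout
    have ha : action N v c = A.trans (.read i s mem cnt) (fun i => (c.tape i).head)
        (portView N v c) := by
      unfold action; rw [hc]; rfl
    have hlt : (i : ℕ) < A.width := by omega
    obtain ⟨c', s', hr, h⟩ := ih ⟨i + 1, by omega⟩ (fun p => bump (cnt p) (portView N v c p))
      (step N v c) (by simp; omega) (by simp only [step, ha, trans]; rw [dif_pos hlt])
      (by
        intro p
        simp only [portView, hin]
        rcases hp : N.port v p with _ | e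
        · simp [bump, hcnt, hn0 p hp]
        · rcases h : n p - i with _ | m
          · simp only [List.replicate_zero, bump, hcnt]; omega
          · simp only [List.replicate_succ, bump, hcnt]
            have := hn p
            omega)
      (by
        intro p
        simp only [step, ha, trans, hin, if_true, List.tail_replicate]
        congr 1)
      (by
        intro p
        simp only [step, ha, trans, hout]; cases N.port v p <;> rfl)
    have htab : (step N v c).table = c.table := by simp only [step, ha, trans]
    rw [htab] at h
    refine ⟨c', s', ?_, h⟩
    have : j + 1 + 1 + (A.width + 1) = (j + 1 + (A.width + 1)) + 1 := by omega
    rw [this]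
    exact Runs.more c _ _ (by rw [ha]; rfl) hr

/-! ### The machine follows the automaton -/

variable (A) (r : V)

/-- The configurations before the computation of round `t` agree with the run of the automaton. -/
structure PreInv (t : ℕ) (v : V) (c : Config A.machine) : Prop where
  -- A sleeping node skips the round, so it must still be in its start configuration, memories
  -- included.
  awake_or : c.awake ∨ (A.run N r t v = A.start ∧
    c.state = Control.read 0 A.start (fun _ => A.quiet) (fun _ => 0))
  mem : ∃ mem : Fin D → A.Msg, c.state = Control.read 0 (A.run N r t v) mem (fun _ => 0) ∧
    (∀ p, N.port v p = none → c.inBuf p = []) ∧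
    ∀ p w q, N.port v p = some (w, q) →
      (c.inBuf p = [] ∧ mem p = A.out (A.run N r t w) q) ∨
        c.inBuf p = List.replicate (A.len (A.out (A.run N r t w) q)) true
  outBuf : ∀ p, c.outBuf p = []
  table : c.table = ⋃ i ≤ t, A.tab (A.run N r i v)

/-- The configurations after the computation of round `t` agree with the run of the automaton. -/
structure PostInv (t : ℕ) (v : V) (c : Config A.machine) : Prop where
  awake_or : c.awake ∨ (A.run N r (t + 1) v = A.start ∧
    c.state = Control.read 0 A.start (fun _ => A.quiet) (fun _ => 0))
  mem : ∃ mem : Fin D → A.Msg, c.state = Control.read 0 (A.run N r (t + 1) v) mem (fun _ => 0) ∧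
    ∀ p w q, N.port v p = some (w, q) → mem p = A.out (A.run N r t w) q
  outBuf : ∀ p, c.outBuf p = if N.port v p = none then [] else
    List.replicate (A.sendLen (A.run N r t v) (A.run N r (t + 1) v) p) true
  table : c.table = ⋃ i ≤ t + 1, A.tab (A.run N r i v)

variable {A} {N} {r}

lemma biUnion_le_succ {α : Type} (f : ℕ → Set α) (t : ℕ) :
    ⋃ i ≤ t + 1, f i = (⋃ i ≤ t, f i) ∪ f (t + 1) := by
  ext a
  simp only [Set.mem_iUnion, Set.mem_union, exists_prop]
  constructor
  · rintro ⟨i, hi, h⟩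
    rcases Nat.le_succ_iff.1 hi with h' | rfl
    · exact Or.inl ⟨i, h', h⟩
    · exact Or.inr h
  · rintro (⟨i, hi, h⟩ | h)
    · exact ⟨i, by omega, h⟩
    · exact ⟨t + 1, le_rfl, h⟩

/-- For an active node, each port yields the neighbor's current value, from memory if the buffer is
empty and from the word otherwise, so the decoded input is the automaton's view. For an idle node
all buffers are empty and all memories quiet, so every neighbor exposes `quiet`, and `next_start`
says that doing nothing is the right transition. -/
lemma PreInv.exists_computes {t : ℕ} {v : V} {c : Config A.machine} (h : PreInv A N r t v c) :
    ∃ s c', Computes N v c s c' ∧ s ≤ 2 * A.width + 2 ∧ PostInv A N r t v c' := by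
  obtain ⟨mem, hst, hin0, hin⟩ := h.mem
  by_cases hact : c.Active
  · have hn : ∀ p, ∃ n, n ≤ A.width ∧ (N.port v p = none → n = 0) ∧
        c.inBuf p = List.replicate n true ∧
        ∀ w q, N.port v p = some (w, q) → A.decode (mem p) n = A.out (A.run N r t w) q := by
      intro p
      rcases hp : N.port v p with _ | ⟨w, q⟩
      · exact ⟨0, Nat.zero_le _, fun _ => rfl, by simp [hin0 p hp], by simp⟩
      · rcases hin p w q hp with ⟨h1, h2⟩ | h1
        · refine ⟨0, Nat.zero_le _, fun _ => rfl, by simp [h1], ?_⟩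
          rintro w' q' h'; cases h'
          rw [A.decode_zero, h2]
        · refine ⟨_, A.len_le _, by simp, h1, ?_⟩
          rintro w' q' h'; cases h'
          rw [A.decode_len]
    choose n hnW hn0 hnin hndec using hn
    obtain ⟨c', s', hr, hs', hc', haw, hout, htab⟩ := runs_read N hnW hn0 A.width 0 (fun _ => 0)
      { c with awake := True } (by simp) hst (by simp) (by simpa using hnin) h.outBuf
    have hview : (fun p => (N.port v p).map fun _ => A.decode (mem p) (n p)) =
        A.view N (A.run N r t) v := by
      funext p
      rcases hp : N.port v p with _ | ⟨w, q⟩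
      · simp [view, hp]
      · simp [view, hp, hndec p w q hp]
    have hs : s' = A.run N r (t + 1) v := by rw [hs', hview]; rfl
    subst hs
    refine ⟨_, c', Or.inl ⟨hact, hr⟩, by omega, ⟨Or.inl (by rw [haw]; trivial), ⟨_, hc', ?_⟩, hout, ?_⟩⟩
    · intro p w q hp; exact hndec p w q hp
    · rw [htab, biUnion_le_succ, h.table]
  · have hact' := hact
    simp only [Config.Active, not_or, not_exists, not_not] at hact
    obtain ⟨haw, hempty⟩ := hact
    obtain ⟨hstart, hst'⟩ := h.awake_or.resolve_left haw
    have hmem : mem = fun _ => A.quiet := by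
      have h0 := hst.symm.trans hst'
      injection h0
    have hq : ∀ p w q, N.port v p = some (w, q) → A.out (A.run N r t w) q = A.quiet := by
      intro p w q hp
      rcases hin p w q hp with ⟨_, h2⟩ | h1
      · rw [← h2, hmem]
      · rw [hempty p] at h1
        have := congrArg List.length h1
        simp at this
        exact absurd this.symm (A.len_pos _)
    have hnext : A.run N r (t + 1) v = A.start := by
      change A.next (A.run N r t v) _ = _
      rw [hstart]
      apply A.next_start
      intro p x hx
      simp only [view, Option.map_eq_some_iff] at hx
      obtain ⟨⟨w, q⟩, hp, rfl⟩ := hx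
      exact hq p w q hp
    refine ⟨0, c, Or.inr ⟨hact', rfl, rfl⟩, Nat.zero_le _, ⟨Or.inr ⟨hnext, hst'⟩,
      ⟨mem, by rw [hst, hnext, hstart], ?_⟩, ?_, ?_⟩⟩
    · intro p w q hp; rw [hq p w q hp, hmem]
    · intro p; rw [h.outBuf, hnext, hstart]; simp [sendLen]
    · rw [biUnion_le_succ, hnext, A.tab_start, Set.union_empty, h.table]

lemma preInv_initial (v : V) : PreInv A N r 0 v (initial N A.machine r v) := by
  have hst : (initial N A.machine r v).state =
      Control.read 0 (A.run N r 0 v) (fun _ => A.quiet) (fun _ => 0) := by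
    simp only [initial, run]; split_ifs <;> rfl
  have hout : ∀ w p, A.out (A.run N r 0 w) p = A.quiet := by
    intro w p; simp only [run]; split_ifs
    · exact A.out_startReq p
    · exact A.out_start p
  refine ⟨?_, ⟨_, hst, fun _ _ => rfl, fun p w q _ => Or.inl ⟨rfl, (hout w q).symm⟩⟩, fun _ => rfl, ?_⟩
  · by_cases h : v = r
    · exact Or.inl h
    · right
      have : A.run N r 0 v = A.start := by simp [run, h]
      exact ⟨this, by rw [hst, this]⟩
  · have : A.tab (A.run N r 0 v) = ∅ := by
      simp only [run]; split_ifs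
      · exact A.tab_startReq
      · exact A.tab_start
    simp [initial, this]

/-- An empty word from `w` means that its exposed value did not change, so the memory stays correct;
otherwise the word is the code of the new value. -/
lemma preInv_deliver {t : ℕ} {c : V → Config A.machine} (h : ∀ v, PostInv A N r t v (c v)) (v : V) :
    PreInv A N r (t + 1) v (deliver N c v) := by
  obtain ⟨mem, hst, hmem⟩ := (h v).mem
  refine ⟨(h v).awake_or, ⟨mem, hst, ?_, ?_⟩, fun _ => rfl, (h v).table⟩
  · intro p hp; simp [deliver, hp]
  · intro p w q hp
    have hb : (deliver N c v).inBuf p = (c w).outBuf q := by simp [deliver, hp]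
    have hq := N.port_symm _ _ _ _ hp
    rw [hb, (h w).outBuf, hq, hmem p w q hp, sendLen]
    simp only [reduceCtorEq, if_false]
    split_ifs with h1
    · left; exact ⟨rfl, h1⟩
    · right; rfl

/-- The machine of an automaton has an execution on every network that follows the run of the
automaton: constantly many steps per round, short messages, messages only where an exposed value
changes, and tables collecting the stored tuples. -/
theorem exists_execution (A : Automaton D ℓ) (N : Network D V) (r : V) :
    ∃ E : Execution N A.machine r,
      (∀ t v, E.time t v ≤ 2 * A.width + 2) ∧
      (∀ t v p, ((E.post t v).outBuf p).length ≤ A.width) ∧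
      (∀ t v p, (E.post t v).outBuf p ≠ [] → A.out (A.run N r t v) p ≠ A.out (A.run N r (t + 1) v) p) ∧
      (∀ t v, (E.pre t v).table = ⋃ i ≤ t, A.tab (A.run N r i v)) ∧
      ∀ t v, (E.post t v).table = ⋃ i ≤ t + 1, A.tab (A.run N r i v) := by
  -- Bundling the invariant with the configurations turns a round into a total function, which can
  -- be iterated by recursion below.
  have key : ∀ t (pre : {c : V → Config A.machine // ∀ v, PreInv A N r t v (c v)}),
      ∃ (time : V → ℕ) (post : V → Config A.machine), (∀ v, Computes N v (pre.1 v) (time v) (post v)) ∧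
        (∀ v, time v ≤ 2 * A.width + 2) ∧ ∀ v, PostInv A N r t v (post v) := by
    rintro t ⟨pre, hpre⟩
    choose time post h1 h2 h3 using fun v => (hpre v).exists_computes
    exact ⟨time, post, h1, h2, h3⟩
  choose time post hcomp htime hpost using key
  let pre : ∀ t, {c : V → Config A.machine // ∀ v, PreInv A N r t v (c v)} :=
    fun t => Nat.rec ⟨initial N A.machine r, preInv_initial⟩
      (fun t c => ⟨deliver N (post t c), preInv_deliver (hpost t c)⟩) t
  refine ⟨⟨fun t => (pre t).1, fun t => post t (pre t), fun t => time t (pre t), fun _ => rfl,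
    fun t v => hcomp t (pre t) v, fun _ _ => rfl⟩, fun t v => htime t (pre t) v, ?_, ?_,
    fun t v => ((pre t).2 v).table, fun t v => (hpost t (pre t) v).table⟩
  · intro t v p
    change ((post t (pre t) v).outBuf p).length ≤ _
    rw [(hpost t (pre t) v).outBuf p]
    split_ifs
    · simp
    · simpa using A.sendLen_le _ _ _
  · intro t v p hp heq
    change (post t (pre t) v).outBuf p ≠ [] at hp
    rw [(hpost t (pre t) v).outBuf p] at hp
    simp [sendLen, heq] at hp

end Automaton

/-! ### Semantics of local formulas -/

section Logic

variable {V : Type} {ℓ : ℕ}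

/-- Satisfaction with all quantifiers restricted to the set `B`. -/
def SatIn {M : Type} [(lang ℓ).Structure M] (B : Set M) :
    {m : ℕ} → BForm ℓ m → (Fin (ℓ + 1) → M) → (Fin m → M) → Prop
  | _, .falsum, _, _ => False
  | _, .equal s t, a, xs => s.realize (Sum.elim a xs) = t.realize (Sum.elim a xs)
  | _, .rel R ts, a, xs => Structure.RelMap R fun i => (ts i).realize (Sum.elim a xs)
  | _, .imp φ ψ, a, xs => SatIn B φ a xs → SatIn B ψ a xs
  | _, .all φ, a, xs => ∀ z ∈ B, SatIn B φ a (Fin.snoc xs z)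

lemma dist_le_succ_iff {G : SimpleGraph V} (hG : G.Connected) (u w : V) (k : ℕ) :
    G.dist u w ≤ k + 1 ↔ ∃ z, G.dist u z ≤ k ∧ (z = w ∨ G.Adj z w) := by
  constructor
  · intro h
    -- The walk starts at `w`, so that `cases` splits off the edge at `w`.
    obtain ⟨p, hp⟩ := hG.exists_walk_length_eq_dist w u
    cases p with
    | nil => exact ⟨u, by simp, Or.inl rfl⟩
    | @cons _ z _ hadj q =>
      refine ⟨z, ?_, Or.inr hadj.symm⟩
      have h1 := SimpleGraph.dist_le q
      rw [SimpleGraph.Walk.length_cons, SimpleGraph.dist_comm] at hp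
      rw [SimpleGraph.dist_comm]
      omega
  · rintro ⟨z, hz, rfl | hadj⟩
    · omega
    · have h1 := hG.dist_triangle (u := u) (v := z) (w := w)
      have h2 := SimpleGraph.dist_eq_one_iff_adj.2 hadj
      omega

lemma realize_distLE {G : SimpleGraph V} (hG : G.Connected) (r : V) (I : Set (Fin (ℓ + 1) → V))
    (k : ℕ) : ∀ a : Fin 2 → V,
    (letI := interp G r I; (distLE ℓ k).Realize a) ↔ G.dist (a 0) (a 1) ≤ k := by
  let := interp G r I
  induction k with
  | zero =>
    intro a
    simp [distLE, hG.dist_eq_zero_iff]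
  | succ k ih =>
    intro a
    rw [dist_le_succ_iff hG]
    simp only [distLE, Formula.Realize, BoundedFormula.realize_ex, BoundedFormula.realize_inf,
      BoundedFormula.realize_sup, BoundedFormula.realize_bdEqual]
    refine exists_congr fun z => and_congr ?_ (or_congr ?_ ?_)
    · rw [BoundedFormula.realize_relabel]
      have := ih ![a 0, z]
      simp only [Formula.Realize] at this
      simp only [Matrix.cons_val_zero, Matrix.cons_val_one] at this
      rw [← this]
      refine iff_of_eq (congrArg₂ _ ?_ (Subsingleton.elim _ _))
      funext i
      fin_cases i <;> simp [Fin.snoc]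
    · simp [Fin.snoc]
    · change G.Adj _ _ ↔ _
      simp [Fin.snoc]

lemma realize_relativize {G : SimpleGraph V} (hG : G.Connected) (r : V)
    (I : Set (Fin (ℓ + 1) → V)) (k : ℕ) {m : ℕ} (φ : BForm ℓ m) (a : Fin (ℓ + 1) → V) :
    ∀ xs : Fin m → V, letI := interp G r I
    ((relativize k φ).Realize a xs ↔ SatIn {z | G.dist (a 0) z ≤ k} φ a xs) := by
  let := interp G r I
  induction φ with
  | falsum => intro xs; rfl
  | equal s t => intro xs; rfl
  | rel R ts => intro xs; rfl
  | imp φ ψ ih1 ih2 =>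
    intro xs
    simp only [relativize, BoundedFormula.realize_imp, SatIn]
    exact imp_congr (ih1 xs) (ih2 xs)
  | @all m φ ih =>
    intro xs
    simp only [relativize, BoundedFormula.realize_all, BoundedFormula.realize_imp, SatIn]
    refine forall_congr' fun z => imp_congr ?_ (ih _)
    rw [Set.mem_ofPred_eq]
    have := realize_distLE (ℓ := ℓ) hG r I k ![a 0, z]
    simp only [Formula.Realize, Matrix.cons_val_zero, Matrix.cons_val_one] at this
    rw [← this]
    refine (BoundedFormula.realize_relabel (L := lang ℓ) (M := V) (m := m + 1) (n := 0)
      (φ := distLE ℓ k) (g := ![Sum.inl 0, Sum.inr (Fin.last m)]) (v := a)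
      (xs := (Fin.snoc xs z : Fin (m + 1) → V))).trans ?_
    refine iff_of_eq (congrArg₂ _ ?_ (Subsingleton.elim _ _))
    funext i
    fin_cases i
    · simp
    · simp only [Function.comp, Fin.castAdd_zero, Fin.cast_refl]
      change Fin.snoc (α := fun _ => V) xs z (Fin.last m) = z
      simp

lemma sat_localize {G : SimpleGraph V} (hG : G.Connected) (r : V) (I : Set (Fin (ℓ + 1) → V))
    (k : ℕ) (φ : Form ℓ) (a : Fin (ℓ + 1) → V) :
    Sat G r I (localize k φ) a ↔
      (∀ i, G.dist (a 0) (a i) ≤ k) ∧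
        letI := interp G r I
        SatIn {z | G.dist (a 0) z ≤ k} φ a default := by
  let := interp G r I
  unfold Sat localize Formula.Realize
  rw [BoundedFormula.realize_inf, BoundedFormula.realize_iInf, and_comm]
  refine and_congr ?_ (realize_relativize hG r I k φ a _)
  have key : ∀ i : Fin ℓ, (BoundedFormula.relabel (n := 0) (k := 0) ![Sum.inl 0, Sum.inl i.succ]
      (distLE ℓ k) : BForm ℓ 0).Realize a (default : Fin 0 → V) ↔ G.dist (a 0) (a i.succ) ≤ k := by
    intro i
    have := realize_distLE (ℓ := ℓ) hG r I k ![a 0, a i.succ]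
    simp only [Formula.Realize, Matrix.cons_val_zero, Matrix.cons_val_one] at this
    rw [← this]
    refine (BoundedFormula.realize_relabel (n := 0) (m := 0)).trans ?_
    refine iff_of_eq (congrArg₂ _ ?_ (Subsingleton.elim _ _))
    funext i
    fin_cases i <;> rfl
  -- The bound for the entry `x` itself is trivial; only the entries `y_i` have a conjunct.
  rw [Fin.forall_fin_succ]
  simp only [SimpleGraph.dist_self, Nat.zero_le, true_and]
  exact forall_congr' key

/-- Structures for the language given by a binary relation, a predicate and a set of tuples. -/
@[reducible] def relStructure {κ : Type} (adj : κ → κ → Prop) (req : κ → Prop)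
    (rel : Set (Fin (ℓ + 1) → κ)) : (lang ℓ).Structure κ where
  funMap := fun f => Empty.elim f
  RelMap := fun {_} R =>
    match R with
    | RelSym.G => fun x => adj (x 0) (x 1)
    | RelSym.reqNode => fun x => req (x 0)
    | RelSym.T => fun x => x ∈ rel

lemma realize_term_comp {V κ α : Type} [(lang ℓ).Structure V] [(lang ℓ).Structure κ] (f : V → κ)
    (t : (lang ℓ).Term α) (a : α → V) : t.realize (f ∘ a) = f (t.realize a) := by
  cases t with
  | var i => rfl
  | func g _ => exact Empty.elim g

lemma realize_term_mem {V α : Type} [(lang ℓ).Structure V] (B : Set V)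
    (t : (lang ℓ).Term α) (a : α → V) (ha : ∀ i, a i ∈ B) : t.realize a ∈ B := by
  cases t with
  | var i => exact ha i
  | func g _ => exact Empty.elim g

/-- Restricted satisfaction is preserved by maps that are embeddings on the restricting set. -/
lemma satIn_image_iff {κ : Type} {G : SimpleGraph V} {r : V} {I : Set (Fin (ℓ + 1) → V)}
    {adj : κ → κ → Prop} {req : κ → Prop} {rel : Set (Fin (ℓ + 1) → κ)} (f : V → κ) (B : Set V)
    (hinj : Set.InjOn f B) (hadj : ∀ u ∈ B, ∀ w ∈ B, G.Adj u w ↔ adj (f u) (f w))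
    (hreq : ∀ u ∈ B, u = r ↔ req (f u))
    (hrel : ∀ b : Fin (ℓ + 1) → V, (∀ i, b i ∈ B) → (b ∈ I ↔ f ∘ b ∈ rel))
    {m : ℕ} (φ : BForm ℓ m) (a : Fin (ℓ + 1) → V) (ha : ∀ i, a i ∈ B) :
    ∀ xs : Fin m → V, (∀ i, xs i ∈ B) →
      ((letI := interp G r I; SatIn B φ a xs) ↔
        (letI := relStructure adj req rel; SatIn (f '' B) φ (f ∘ a) (f ∘ xs))) := by
  let i1 := interp G r I
  let i2 := relStructure adj req rel
  have helim : ∀ {m : ℕ} (xs : Fin m → V), Sum.elim (f ∘ a) (f ∘ xs) = f ∘ Sum.elim a xs := by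
    intro m xs; exact (Sum.comp_elim f a xs).symm
  have hmem : ∀ {m : ℕ} (xs : Fin m → V), (∀ i, xs i ∈ B) → ∀ i, Sum.elim a xs i ∈ B := by
    rintro m xs hxs (i | i)
    · exact ha i
    · exact hxs i
  induction φ with
  | falsum => intro xs _; rfl
  | equal s t =>
    intro xs hxs
    simp only [SatIn, helim, realize_term_comp]
    exact (hinj.eq_iff (realize_term_mem B s _ (hmem xs hxs))
      (realize_term_mem B t _ (hmem xs hxs))).symm
  | rel R ts =>
    intro xs hxs
    simp only [SatIn, helim, realize_term_comp]
    have hm := fun i => realize_term_mem B (ts i) _ (hmem xs hxs)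
    cases R with
    | G => exact hadj _ (hm 0) _ (hm 1)
    | reqNode => exact hreq _ (hm 0)
    | T => exact hrel _ hm
  | imp φ ψ ih1 ih2 =>
    intro xs hxs
    simp only [SatIn]
    exact imp_congr (ih1 xs hxs) (ih2 xs hxs)
  | all φ ih =>
    intro xs hxs
    simp only [SatIn, Set.forall_mem_image]
    refine forall_congr' fun z => forall_congr' fun hz => ?_
    have hs : ∀ i, (Fin.snoc xs z : Fin _ → V) i ∈ B := by
      intro i
      refine Fin.lastCases ?_ (fun j => ?_) i
      · simpa using hz
      · simpa using hxs j
    rw [ih _ hs, Fin.comp_snoc]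

/-! ### Stages -/

lemma stage_mono {G : SimpleGraph V} {r : V} (ψ : Form ℓ) : Monotone (stage G r ψ) :=
  monotone_nat_of_le_succ fun _ => Set.subset_union_right

lemma dist_le_of_mem_stage {G : SimpleGraph V} (hG : G.Connected) {r : V} {k : ℕ} {φ : Form ℓ}
    {n : ℕ} : ∀ {a : Fin (ℓ + 1) → V}, a ∈ stage G r (localize k φ) n →
      ∀ i, G.dist (a 0) (a i) ≤ k := by
  induction n with
  | zero => intro a h; exact absurd h (Set.notMem_empty a)
  | succ n ih =>
    rintro a (h | h)
    · exact ((sat_localize hG r _ k φ a).1 h).1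
    · exact ih h

lemma stage_eq_of_succ_eq {G : SimpleGraph V} {r : V} {ψ : Form ℓ} {n : ℕ}
    (h : stage G r ψ (n + 1) = stage G r ψ n) : ∀ m, n ≤ m → stage G r ψ m = stage G r ψ n := by
  intro m hm
  induction m, hm using Nat.le_induction with
  | base => rfl
  | succ m hm ih =>
    rw [← h]
    simp only [stage, ih]

/-- If all stages have at most `M` elements, the fixpoint is reached at stage `M`. -/
lemma stage_eq_fixpoint [Finite V] {G : SimpleGraph V} {r : V} {ψ : Form ℓ} {M : ℕ}
    (hM : ∀ n, (stage G r ψ n).ncard ≤ M) {m : ℕ} (hm : M ≤ m) :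
    stage G r ψ m = fixpoint G r ψ := by
  obtain ⟨n, hn, h⟩ : ∃ n ≤ M, stage G r ψ (n + 1) = stage G r ψ n := by
    by_contra! hne
    -- Every proper inclusion adds a tuple, so stage `M + 1` would be too large.
    have hlt : ∀ n, n ≤ M + 1 → n ≤ (stage G r ψ n).ncard := by
      intro n
      induction n with
      | zero => intro _; exact Nat.zero_le _
      | succ n ih =>
        intro hn
        have h1 : stage G r ψ n ⊂ stage G r ψ (n + 1) :=
          (stage_mono ψ n.le_succ).ssubset_of_ne (hne n (by omega)).symm
        have h2 := Set.ncard_lt_ncard h1 (Set.toFinite _)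
        have := ih (by omega)
        omega
    have := hlt (M + 1) le_rfl
    have := hM (M + 1)
    omega
  have hst := stage_eq_of_succ_eq h
  refine Set.Subset.antisymm (Set.subset_iUnion _ m) (Set.iUnion_subset fun i => ?_)
  rw [hst m (hn.trans hm)]
  rcases le_total n i with h' | h'
  · exact (hst i h').le
  · exact stage_mono ψ h'

end Logic

/-! ### The evaluation automaton -/

/-- Colors: sufficiently many to color the nodes so that nodes at distance at most `3k + 1` have
different colors. -/
abbrev Color (D k : ℕ) : Type := Option {l : List (Fin D) // l.length ≤ 3 * k + 1}

instance (D k : ℕ) : Finite {l : List (Fin D) // l.length ≤ k} :=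
  (List.finite_length_le (Fin D) k).to_subtype

/-- Facts about the network in terms of colors: there is a node of color `c`, it is the requesting
node, its port `p` leads to a node of color `c'`, a tuple belongs to the fixpoint relation. -/
inductive Atom (D ℓ : ℕ) (κ : Type)
  | node (c : κ)
  | req (c : κ)
  | adj (c : κ) (p : Fin D) (c' : κ)
  | rel (b : Fin (ℓ + 1) → κ)

instance (D ℓ : ℕ) (κ : Type) [Finite κ] : Finite (Atom D ℓ κ) := by
  let f : κ ⊕ κ ⊕ (κ × Fin D × κ) ⊕ (Fin (ℓ + 1) → κ) → Atom D ℓ κ :=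
    Sum.elim .node (Sum.elim .req (Sum.elim (fun x => .adj x.1 x.2.1 x.2.2) .rel))
  refine Finite.of_surjective f ?_
  rintro (c | c | ⟨c, p, c'⟩ | b)
  · exact ⟨.inl c, rfl⟩
  · exact ⟨.inr (.inl c), rfl⟩
  · exact ⟨.inr (.inr (.inl (c, p, c'))), rfl⟩
  · exact ⟨.inr (.inr (.inr b)), rfl⟩

/-- Status of a node in the depth-first traversal: not yet visited; waiting for its knowledge to
be up to date; inspecting port `j`; waiting for the child at port `p`; finished. -/
inductive Status (D k : ℕ)
  | fresh
  | hold (i : Fin (3 * k + 3))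
  | probe (j : Fin (D + 1))
  | call (p : Fin D)
  | done

instance (D k : ℕ) : Finite (Status D k) := by
  let f : Fin (3 * k + 3) ⊕ Fin (D + 1) ⊕ Fin D ⊕ Bool → Status D k :=
    Sum.elim .hold (Sum.elim .probe (Sum.elim .call fun b => if b then .fresh else .done))
  refine Finite.of_surjective f ?_
  rintro (_ | i | j | p | _)
  · exact ⟨.inr (.inr (.inr true)), rfl⟩
  · exact ⟨.inl i, rfl⟩
  · exact ⟨.inr (.inl j), rfl⟩
  · exact ⟨.inr (.inr (.inl p)), rfl⟩
  · exact ⟨.inr (.inr (.inr false)), rfl⟩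

/-- The states of the automaton.  `know j` collects atoms from nodes at distance at most `j`. -/
structure NodeState (D ℓ k : ℕ) where
  status : Status D k
  req : Prop
  col : Option (Color D k)
  know : Fin (3 * k + 2) → Set (Atom D ℓ (Color D k))
  go : Prop
  -- The clock never stops; as it is not exposed, it causes no messages.
  clock : Fin (2 * k + 1)

instance (D ℓ k : ℕ) : Finite (NodeState D ℓ k) := by
  let f : NodeState D ℓ k → Status D k × Prop × Option (Color D k) ×
      (Fin (3 * k + 2) → Set (Atom D ℓ (Color D k))) × Prop × Fin (2 * k + 1) :=
    fun s => (s.status, s.req, s.col, s.know, s.go, s.clock)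
  refine Finite.of_injective f ?_
  rintro ⟨a, b, c, d, e, g⟩ ⟨a', b', c', d', e', g'⟩ h
  simpa [f] using h

/-- The values exposed to a neighbor. -/
structure Exposed (D ℓ k : ℕ) where
  fresh : Prop
  done : Prop
  called : Prop
  col : Option (Color D k)
  know : Fin (3 * k + 2) → Set (Atom D ℓ (Color D k))
  go : Prop

instance (D ℓ k : ℕ) : Finite (Exposed D ℓ k) := by
  let f : Exposed D ℓ k → Prop × Prop × Prop × Option (Color D k) ×
      (Fin (3 * k + 2) → Set (Atom D ℓ (Color D k))) × Prop :=
    fun s => (s.fresh, s.done, s.called, s.col, s.know, s.go)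
  refine Finite.of_injective f ?_
  rintro ⟨a, b, c, d, e, g⟩ ⟨a', b', c', d', e', g'⟩ h
  simpa [f] using h

section Automaton

variable {D ℓ k : ℕ}

/-- The values that a node exposes at port `q`. -/
def NodeState.expose (s : NodeState D ℓ k) (q : Fin D) : Exposed D ℓ k where
  fresh := s.status = .fresh
  done := s.status = .done
  called := s.status = .call q
  col := s.col
  know := s.know
  go := s.go

open Classical in
/-- The traversal: a node that is visited for the first time waits, then inspects its ports one by
one, and visits the neighbors that are still fresh. -/
noncomputable def NodeState.nextStatus (s : NodeState D ℓ k) (m : Fin D → Option (Exposed D ℓ k)) :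
    Status D k :=
  match s.status with
  | .fresh => if s.req ∨ ∃ p e, m p = some e ∧ e.called then .hold 0 else .fresh
  | .hold i => if h : (i : ℕ) < 3 * k + 2 then .hold ⟨i + 1, by omega⟩ else .probe 0
  | .probe j =>
    if h : (j : ℕ) < D then
      if ∃ e, m ⟨j, h⟩ = some e ∧ e.fresh then .call ⟨j, h⟩ else .probe ⟨j + 1, by omega⟩
    else .done
  | .call p => if ∃ e, m p = some e ∧ e.done then .probe p.succ else .call p
  | .done => .done

section NextStatus

variable {s : NodeState D ℓ k} {m : Fin D → Option (Exposed D ℓ k)}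

open Classical in
lemma NodeState.nextStatus_of_fresh (h : s.status = .fresh) : s.nextStatus m =
    if s.req ∨ ∃ p e, m p = some e ∧ e.called then .hold 0 else .fresh := by
  unfold nextStatus; rw [h]

lemma NodeState.nextStatus_of_hold {i} (h : s.status = .hold i) : s.nextStatus m =
    if h : (i : ℕ) < 3 * k + 2 then .hold ⟨i + 1, by omega⟩ else .probe 0 := by
  unfold nextStatus; rw [h]

open Classical in
lemma NodeState.nextStatus_of_probe {j} (h : s.status = .probe j) : s.nextStatus m =
    if h : (j : ℕ) < D then
      if ∃ e, m ⟨j, h⟩ = some e ∧ e.fresh then .call ⟨j, h⟩ else .probe ⟨j + 1, by omega⟩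
    else .done := by
  unfold nextStatus; rw [h]

open Classical in
lemma NodeState.nextStatus_of_call {p} (h : s.status = .call p) : s.nextStatus m =
    if ∃ e, m p = some e ∧ e.done then .probe p.succ else .call p := by
  unfold nextStatus; rw [h]

lemma NodeState.nextStatus_of_done (h : s.status = .done) : s.nextStatus m = .done := by
  unfold nextStatus; rw [h]

end NextStatus

open Classical in
/-- A color that does not occur in the given atoms (if possible). -/
noncomputable def pickColor (K : Set (Atom D ℓ (Color D k))) : Color D k :=
  if h : ∃ c, Atom.node c ∉ K then h.choose else default

open Classical in
/-- The color is chosen at the end of the waiting time. -/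
noncomputable def NodeState.nextCol (s : NodeState D ℓ k) : Option (Color D k) :=
  if s.col = none ∧ s.status = .hold (Fin.last (3 * k + 2)) then
    some (pickColor (s.know (Fin.last (3 * k + 1)))) else s.col

/-- The index `k` of the knowledge about the `k`-neighborhood. -/
def radius (k : ℕ) : Fin (3 * k + 2) := ⟨k, by omega⟩

/-- Evaluation of a local formula in the structure described by a set of atoms. -/
def Eval (φ : Form ℓ) (K : Set (Atom D ℓ (Color D k))) (b : Fin (ℓ + 1) → Color D k) : Prop :=
  (∀ i, Atom.node (b i) ∈ K) ∧
    letI := relStructure (ℓ := ℓ) (fun c c' => ∃ p, Atom.adj c p c' ∈ K) (fun c => Atom.req c ∈ K)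
      {b | Atom.rel b ∈ K}
    SatIn {c | Atom.node c ∈ K} φ b default

/-- The atoms about itself that a node adds to its knowledge. -/
inductive NodeState.OwnAtom (φ : Form ℓ) (s : NodeState D ℓ k) (m : Fin D → Option (Exposed D ℓ k)) :
    Atom D ℓ (Color D k) → Prop
  | node (c) : s.col = some c → OwnAtom φ s m (.node c)
  | req (c) : s.col = some c → s.req → OwnAtom φ s m (.req c)
  | adj (c p c' e) : s.col = some c → m p = some e → e.col = some c' → OwnAtom φ s m (.adj c p c')
  | rel (b) : s.col = some (b 0) → s.go → s.clock = Fin.last (2 * k) → Eval φ (s.know (radius k)) b →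
      OwnAtom φ s m (.rel b)

open Classical in
/-- The transition function of the automaton. -/
noncomputable def NodeState.next (φ : Form ℓ) (s : NodeState D ℓ k)
    (m : Fin D → Option (Exposed D ℓ k)) : NodeState D ℓ k where
  status := s.nextStatus m
  req := s.req
  col := s.nextCol
  -- Passing from layer `i` to layer `i + 1` at each edge limits how far an atom travels; beyond
  -- that distance colors would be ambiguous.
  know := fun j => s.know j ∪ {a | s.OwnAtom φ m a} ∪
    {a | ∃ p e, m p = some e ∧ ∃ i : Fin (3 * k + 2), (i : ℕ) + 1 = j ∧ a ∈ e.know i}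
  go := s.go ∨ (s.req ∧ s.status = .done) ∨ ∃ p e, m p = some e ∧ e.go
  -- The addition in `Fin (2 * k + 1)` is cyclic.
  clock := if s.go then s.clock + 1 else s.clock

/-- A trace of ports leads from color `c` to color `c'` according to a set of atoms. -/
def TraceIn (K : Set (Atom D ℓ (Color D k))) : Color D k → List (Fin D) → Color D k → Prop
  | c, [], c' => c = c'
  | c, p :: ps, c' => ∃ c'', Atom.adj c p c'' ∈ K ∧ TraceIn K c'' ps c'

/-- The stored tuples: all short traces to the colors of the tuples of the relation. -/
def NodeState.answers (s : NodeState D ℓ k) : Set (Fin ℓ → List (Fin D)) :=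
  {e | ∃ b, Atom.rel b ∈ s.know 0 ∧
    ∀ i, (e i).length ≤ k ∧ TraceIn (s.know (radius k)) (b 0) (e i) (b i.succ)}

lemma NodeState.finite_answers (s : NodeState D ℓ k) : s.answers.Finite := by
  refine (Set.Finite.pi' fun _ => List.finite_length_le (Fin D) k).subset ?_
  rintro e ⟨b, _, h⟩ i
  exact (h i).1

/-- The initial state. -/
def NodeState.init (req : Prop) : NodeState D ℓ k := ⟨.fresh, req, none, fun _ => ∅, False, 0⟩

/-- The automaton that evaluates `μ(φ^{(k)}(T))`. -/
noncomputable def evaluator (D : ℕ) {ℓ : ℕ} (k : ℕ) (φ : Form ℓ) : Automaton D ℓ where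
  S := NodeState D ℓ k
  Msg := Exposed D ℓ k
  finite_S := inferInstance
  finite_Msg := inferInstance
  startReq := .init True
  start := .init False
  quiet := ⟨True, False, False, none, fun _ => ∅, False⟩
  out := NodeState.expose
  next := NodeState.next φ
  tab := NodeState.answers
  finite_tab := NodeState.finite_answers
  out_startReq := by intro p; simp [NodeState.expose, NodeState.init]
  out_start := by intro p; simp [NodeState.expose, NodeState.init]
  tab_startReq := by simp [NodeState.answers, NodeState.init]
  tab_start := by simp [NodeState.answers, NodeState.init]
  next_start := by
    intro m hm
    have h1 : ∀ (P : Exposed D ℓ k → Prop), ¬ P ⟨True, False, False, none, fun _ => ∅, False⟩ →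
        ¬ ∃ p e, m p = some e ∧ P e := by
      rintro P hP ⟨p, e, h, h'⟩
      exact hP (hm p e h ▸ h')
    have h2 : (NodeState.init False : NodeState D ℓ k).nextStatus m = .fresh := by
      have := h1 Exposed.called (by simp)
      rw [NodeState.nextStatus_of_fresh rfl, if_neg]
      rintro (h | h)
      · exact h
      · exact this h
    have h3 : ∀ a, ¬ (NodeState.init False : NodeState D ℓ k).OwnAtom φ m a := by
      rintro _ (⟨c, h⟩ | ⟨c, h⟩ | ⟨c, p, c', e, h⟩ | ⟨b, h⟩) <;> simp [NodeState.init] at h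
    have h4 := h1 Exposed.go (by simp)
    have h5 : ∀ j : Fin (3 * k + 2), {a | ∃ p e, m p = some e ∧
        ∃ i : Fin (3 * k + 2), (i : ℕ) + 1 = j ∧ a ∈ e.know i} = ∅ := by
      intro j
      refine Set.eq_empty_of_forall_notMem fun a => ?_
      exact h1 (fun e => ∃ i : Fin (3 * k + 2), (i : ℕ) + 1 = j ∧ a ∈ e.know i) (by simp)
    unfold NodeState.next
    rw [h2]
    simp only [h3, h4, h5, NodeState.nextCol]
    simp [NodeState.init]

end Automaton

/-! ### Runs of the evaluation automaton -/

section Run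

variable {D ℓ k : ℕ} {V : Type} (φ : Form ℓ) (N : Network D V) (r : V)

variable (k) in
/-- The state of node `v` after `t` rounds. -/
noncomputable def st (t : ℕ) (v : V) : NodeState D ℓ k := (evaluator D k φ).run N r t v

variable (k) in
/-- What node `v` sees after `t` rounds. -/
noncomputable def vw (t : ℕ) (v : V) (p : Fin D) : Option (Exposed D ℓ k) :=
  (N.port v p).map fun e => (st k φ N r t e.1).expose e.2

variable {φ N r}

lemma st_succ (t : ℕ) (v : V) : st k φ N r (t + 1) v = (st k φ N r t v).next φ (vw k φ N r t v) := rfl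

lemma vw_eq_some {t : ℕ} {v : V} {p : Fin D} {e : Exposed D ℓ k} :
    vw k φ N r t v p = some e ↔
      ∃ w q, N.port v p = some (w, q) ∧ e = (st k φ N r t w).expose q := by
  simp only [vw, Option.map_eq_some_iff, Prod.exists]
  constructor
  · rintro ⟨w, q, h, rfl⟩; exact ⟨w, q, h, rfl⟩
  · rintro ⟨w, q, h, rfl⟩; exact ⟨w, q, h, rfl⟩

lemma exists_vw {t : ℕ} {v : V} {p : Fin D} (P : Exposed D ℓ k → Prop) :
    (∃ e, vw k φ N r t v p = some e ∧ P e) ↔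
      ∃ w q, N.port v p = some (w, q) ∧ P ((st k φ N r t w).expose q) := by
  simp only [vw_eq_some]
  constructor
  · rintro ⟨e, ⟨w, q, h, rfl⟩, h'⟩; exact ⟨w, q, h, h'⟩
  · rintro ⟨w, q, h, h'⟩; exact ⟨_, ⟨w, q, h, rfl⟩, h'⟩

lemma st_zero (v : V) : st k φ N r 0 v = NodeState.init (v = r) := by
  simp only [st, Automaton.run]
  split_ifs with h
  · simp only [h]; rfl
  · simp only [h]; rfl

lemma st_req (t : ℕ) (v : V) : (st k φ N r t v).req ↔ v = r := by
  induction t with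
  | zero => rw [st_zero]; rfl
  | succ t ih => rw [st_succ]; exact ih

/-! #### Monotonicity -/

lemma know_succ_subset (t : ℕ) (v : V) (j) :
    (st k φ N r t v).know j ⊆ (st k φ N r (t + 1) v).know j := by
  rw [st_succ]
  exact fun a h => Or.inl (Or.inl h)

lemma know_mono {t t' : ℕ} (h : t ≤ t') (v : V) (j) :
    (st k φ N r t v).know j ⊆ (st k φ N r t' v).know j :=
  monotone_nat_of_le_succ (f := fun t => (st k φ N r t v).know j)
    (fun t => know_succ_subset t v j) h

lemma col_succ {t : ℕ} {v : V} {c : Color D k} (h : (st k φ N r t v).col = some c) :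
    (st k φ N r (t + 1) v).col = some c := by
  rw [st_succ]
  simp [NodeState.next, NodeState.nextCol, h]

lemma col_mono {t t' : ℕ} (ht : t ≤ t') {v : V} {c : Color D k}
    (h : (st k φ N r t v).col = some c) : (st k φ N r t' v).col = some c := by
  induction t', ht using Nat.le_induction with
  | base => exact h
  | succ t' _ ih => exact col_succ ih

lemma go_mono {t t' : ℕ} (ht : t ≤ t') {v : V} (h : (st k φ N r t v).go) :
    (st k φ N r t' v).go := by
  induction t', ht using Nat.le_induction with
  | base => exact h
  | succ t' _ ih => rw [st_succ]; exact Or.inl ih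

lemma traceIn_mono {K K' : Set (Atom D ℓ (Color D k))} (h : K ⊆ K') {l : List (Fin D)} :
    ∀ {c c' : Color D k}, TraceIn K c l c' → TraceIn K' c l c' := by
  induction l with
  | nil => exact id
  | cons p l ih => rintro c c' ⟨c'', h1, h2⟩; exact ⟨c'', h h1, ih h2⟩

lemma answers_mono {t t' : ℕ} (ht : t ≤ t') (v : V) :
    (st k φ N r t v).answers ⊆ (st k φ N r t' v).answers := by
  rintro e ⟨b, hb, h⟩
  exact ⟨b, know_mono ht v _ hb, fun i => ⟨(h i).1, traceIn_mono (know_mono ht v _) (h i).2⟩⟩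

/-! #### Propagation of knowledge -/

lemma know_zero_subset (t : ℕ) (v : V) (j) :
    (st k φ N r t v).know 0 ⊆ (st k φ N r t v).know j := by
  induction t with
  | zero => rw [st_zero]; exact fun _ h => h
  | succ t ih =>
    rw [st_succ]
    rintro a ((h | h) | ⟨p, e, _, i, hi, _⟩)
    · exact Or.inl (Or.inl (ih h))
    · exact Or.inl (Or.inr h)
    · simp at hi

lemma know_zero_succ (t : ℕ) (v : V) (a : Atom D ℓ (Color D k)) :
    a ∈ (st k φ N r (t + 1) v).know 0 ↔
      a ∈ (st k φ N r t v).know 0 ∨ (st k φ N r t v).OwnAtom φ (vw k φ N r t v) a := by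
  rw [st_succ]
  constructor
  · rintro ((h | h) | ⟨p, e, _, i, hi, _⟩)
    · exact Or.inl h
    · exact Or.inr h
    · simp at hi
  · rintro (h | h)
    · exact Or.inl (Or.inl h)
    · exact Or.inl (Or.inr h)

/-- Along a shortest path an atom advances one edge and one layer per round. -/
lemma know_of_dist_le (j : ℕ) : ∀ (hj : j < 3 * k + 2) (t : ℕ) (v w : V),
    N.graph.dist v w ≤ j →
    (st k φ N r t w).know 0 ⊆ (st k φ N r (t + N.graph.dist v w) v).know ⟨j, hj⟩ := by
  induction j with
  | zero =>
    intro hj t v w h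
    have hv : v = w := N.connected.dist_eq_zero_iff.1 (by omega)
    subst hv
    simp
  | succ j ih =>
    intro hj t v w h
    by_cases hvw : v = w
    · subst hvw
      simpa using know_zero_subset t v _
    obtain ⟨p, hp⟩ := N.connected.exists_walk_length_eq_dist v w
    cases p with
    | nil => exact absurd rfl hvw
    | @cons _ z _ hadj q =>
      have h1 := SimpleGraph.dist_le q
      have h2 := N.connected.dist_triangle (u := v) (v := z) (w := w)
      have h3 := SimpleGraph.dist_eq_one_iff_adj.2 hadj
      rw [SimpleGraph.Walk.length_cons] at hp
      have h4 : N.graph.dist v w = N.graph.dist z w + 1 := by omega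
      rw [h4, ← add_assoc, st_succ]
      obtain ⟨p, q, hpq⟩ := (N.adj_iff v z).1 hadj
      intro a ha
      refine Or.inr ⟨p, _, vw_eq_some.2 ⟨z, q, hpq, rfl⟩, ⟨j, by omega⟩, rfl, ?_⟩
      exact ih (by omega) t z w (by omega) ha

/-- Converse of `know_of_dist_le`: every atom has a source `w`, and the time bound on `s` records
that it had to travel. This bound is what later prevents a node from seeing stages that are ahead of
its own. -/
lemma exists_of_know (t : ℕ) : ∀ (v : V) (j : Fin (3 * k + 2)) (a : Atom D ℓ (Color D k)),
    a ∈ (st k φ N r t v).know j →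
    ∃ w s, N.graph.dist v w ≤ j ∧ s + N.graph.dist v w ≤ t ∧ a ∈ (st k φ N r s w).know 0 := by
  induction t with
  | zero => intro v j a h; rw [st_zero] at h; exact h.elim
  | succ t ih =>
    intro v j a h
    rw [st_succ] at h
    rcases h with (h | h) | ⟨p, e, he, i, hi, h⟩
    · obtain ⟨w, s, h1, h2, h3⟩ := ih v j a h
      exact ⟨w, s, h1, by omega, h3⟩
    · exact ⟨v, t + 1, by simp, by simp, (know_zero_succ t v a).2 (Or.inr h)⟩
    · obtain ⟨z, q, hz, rfl⟩ := vw_eq_some.1 he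
      obtain ⟨w, s, h1, h2, h3⟩ := ih z i a h
      have h4 := N.connected.dist_triangle (u := v) (v := z) (w := w)
      have h5 := SimpleGraph.dist_eq_one_iff_adj.2 ((N.adj_iff v z).2 ⟨p, q, hz⟩)
      exact ⟨w, s, by omega, by omega, h3⟩

/-! #### Traces -/

lemma exists_follow (n : ℕ) : ∀ v w : V, N.graph.dist v w ≤ n →
    ∃ l : List (Fin D), l.length ≤ n ∧ N.follow v l = some w := by
  intro v w h
  obtain ⟨p, hp⟩ := N.connected.exists_walk_length_eq_dist v w
  suffices ∃ l : List (Fin D), l.length = p.length ∧ N.follow v l = some w by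
    obtain ⟨l, h1, h2⟩ := this
    exact ⟨l, by omega, h2⟩
  clear hp h
  induction p with
  | nil => exact ⟨[], rfl, rfl⟩
  | @cons v z w hadj p ih =>
    obtain ⟨l, h1, h2⟩ := ih
    obtain ⟨p, q, hpq⟩ := (N.adj_iff v z).1 hadj
    exact ⟨p :: l, by simp [h1], by simp [Network.follow, hpq, h2]⟩

end Run

/-! ### The depth-first traversal -/

section Traversal

variable {D ℓ k : ℕ} {V : Type} (φ : Form ℓ) (N : Network D V) (r : V)

variable (k) in
/-- The status of node `v` after `t` rounds. -/
noncomputable def stat (t : ℕ) (v : V) : Status D k := (st k φ N r t v).status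

variable {φ r}

/-- Node `u` waits for its neighbor `w`. -/
def Calls (σ : V → Status D k) (u w : V) : Prop := ∃ p q, σ u = .call p ∧ N.port u p = some (w, q)

variable (r) in
/-- `a :: l` is the path of open calls that ends in the requesting node. -/
def IsStack (σ : V → Status D k) : V → List V → Prop
  | a, [] => a = r
  | a, b :: l => Calls N σ b a ∧ a ∉ b :: l ∧ IsStack σ b l

variable {N}

lemma stat_zero (v : V) : stat k φ N r 0 v = .fresh := by
  rw [stat, st_zero]; rfl

open Classical in
lemma stat_succ_of_fresh {t : ℕ} {v : V} (h : stat k φ N r t v = .fresh) :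
    stat k φ N r (t + 1) v = if v = r ∨ ∃ u, Calls N (stat k φ N r t) u v then .hold 0 else .fresh := by
  rw [stat, st_succ]
  refine (NodeState.nextStatus_of_fresh h).trans ?_
  congr 1
  rw [st_req, eq_iff_iff]
  refine or_congr_right ?_
  simp only [exists_vw (fun e => e.called)]
  constructor
  · rintro ⟨p, w, q, hp, h⟩; exact ⟨w, q, p, h, N.port_symm _ _ _ _ hp⟩
  · rintro ⟨w, q, p, h, hp⟩; exact ⟨p, w, q, N.port_symm _ _ _ _ hp, h⟩

lemma stat_succ_of_hold {t : ℕ} {v : V} {i} (h : stat k φ N r t v = .hold i) :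
    stat k φ N r (t + 1) v =
      if h : (i : ℕ) < 3 * k + 2 then .hold ⟨i + 1, by omega⟩ else .probe 0 := by
  rw [stat, st_succ]
  exact NodeState.nextStatus_of_hold h

open Classical in
lemma stat_succ_of_probe {t : ℕ} {v : V} {j} (h : stat k φ N r t v = .probe j) :
    stat k φ N r (t + 1) v = if h : (j : ℕ) < D then
      if ∃ w q, N.port v ⟨j, h⟩ = some (w, q) ∧ stat k φ N r t w = .fresh then .call ⟨j, h⟩
        else .probe ⟨j + 1, by omega⟩ else .done := by
  rw [stat, st_succ]
  refine (NodeState.nextStatus_of_probe h).trans ?_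
  simp only [exists_vw (fun e => e.fresh)]
  rfl

open Classical in
lemma stat_succ_of_call {t : ℕ} {v : V} {p} (h : stat k φ N r t v = .call p) :
    stat k φ N r (t + 1) v =
      if ∃ w q, N.port v p = some (w, q) ∧ stat k φ N r t w = .done then .probe p.succ
        else .call p := by
  rw [stat, st_succ]
  refine (NodeState.nextStatus_of_call h).trans ?_
  simp only [exists_vw (fun e => e.done)]
  rfl

lemma stat_succ_of_done {t : ℕ} {v : V} (h : stat k φ N r t v = .done) :
    stat k φ N r (t + 1) v = .done := by
  rw [stat, st_succ]
  exact NodeState.nextStatus_of_done h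

lemma stat_done_mono {t t' : ℕ} (ht : t ≤ t') {v : V} (h : stat k φ N r t v = .done) :
    stat k φ N r t' v = .done := by
  induction t', ht using Nat.le_induction with
  | base => exact h
  | succ t' _ ih => exact stat_succ_of_done ih

lemma IsStack.congr {σ σ' : V → Status D k} {l : List V} : ∀ {a : V}, IsStack N r σ a l →
    (∀ u ∈ l, σ' u = σ u) → IsStack N r σ' a l := by
  induction l with
  | nil => intro a h _; exact h
  | cons b l ih =>
    rintro a ⟨⟨p, q, h1, h2⟩, h3, h4⟩ h
    exact ⟨⟨p, q, by rw [h b (by simp), h1], h2⟩, h3, ih h4 fun u hu => h u (by simp [hu])⟩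

lemma IsStack.root_mem {σ : V → Status D k} {l : List V} : ∀ {a : V}, IsStack N r σ a l →
    r ∈ a :: l := by
  induction l with
  | nil => intro a h; simp [show a = r from h]
  | cons b l ih => rintro a ⟨_, _, h⟩; exact List.mem_cons_of_mem _ (ih h)

lemma IsStack.exists_calls {σ : V → Status D k} {l : List V} : ∀ {a : V}, IsStack N r σ a l →
    ∀ u ∈ l, ∃ w ∈ a :: l, Calls N σ u w := by
  induction l with
  | nil => intro a _ u hu; simp at hu
  | cons b l ih =>
    rintro a ⟨h1, _, h3⟩ u hu
    rcases List.mem_cons.1 hu with rfl | hu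
    · exact ⟨a, by simp, h1⟩
    · obtain ⟨w, hw, h⟩ := ih h3 u hu
      exact ⟨w, List.mem_cons_of_mem _ hw, h⟩

lemma Calls.eq {σ : V → Status D k} {u w w' : V} (h : Calls N σ u w) (h' : Calls N σ u w') :
    w = w' := by
  obtain ⟨p, q, h1, h2⟩ := h
  obtain ⟨p', q', h1', h2'⟩ := h'
  rw [h1] at h1'
  cases h1'
  rw [h2] at h2'
  cases h2'
  rfl

variable (N r) in
/-- The invariant of the traversal: there is one top of the stack, and all nodes that are not on the
stack are fresh or done. -/
structure StackInv (σ : V → Status D k) (a : V) (l : List V) : Prop where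
  stack : IsStack N r σ a l
  outside : ∀ u ∉ a :: l, σ u = .fresh ∨ σ u = .done
  top : ∀ p, σ a ≠ .call p

lemma StackInv.mem_of_call {σ : V → Status D k} {a : V} {l : List V} (h : StackInv N r σ a l) {u : V}
    {p} (hu : σ u = .call p) : u ∈ l := by
  by_contra hl
  have ha : u ≠ a := by rintro rfl; exact h.top p hu
  rcases h.outside u (by simp [ha, hl]) with h' | h' <;> simp [hu] at h'

/-- A waiting node calls only one neighbor, and the stack already contains that neighbor. Hence
nobody outside the stack is called. -/
lemma StackInv.calls_mem {σ : V → Status D k} {a : V} {l : List V} (h : StackInv N r σ a l) {u w : V}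
    (hu : Calls N σ u w) : w ∈ a :: l := by
  obtain ⟨p, q, h1, _⟩ := id hu
  obtain ⟨w', hw', h'⟩ := h.stack.exists_calls u (h.mem_of_call h1)
  rwa [hu.eq h']

/-- Nodes outside the stack do not change. -/
lemma StackInv.stat_succ_outside {t : ℕ} {a : V} {l : List V} (h : StackInv N r (stat k φ N r t) a l)
    {u : V} (hu : u ∉ a :: l) : stat k φ N r (t + 1) u = stat k φ N r t u := by
  classical
  rcases h.outside u hu with h' | h'
  · rw [stat_succ_of_fresh h', if_neg, h']
    rintro (rfl | ⟨w, hw⟩)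
    · exact hu h.stack.root_mem
    · exact hu (h.calls_mem hw)
  · rw [stat_succ_of_done h', h']

/-- A waiting node does not change if its child is not done. -/
lemma stat_succ_of_calls {t : ℕ} {u w : V} (h : Calls N (stat k φ N r t) u w)
    (hw : stat k φ N r t w ≠ .done) : stat k φ N r (t + 1) u = stat k φ N r t u := by
  classical
  obtain ⟨p, q, h1, h2⟩ := h
  rw [stat_succ_of_call h1, if_neg, h1]
  rintro ⟨w', q', h3, h4⟩
  rw [h2] at h3
  cases h3
  exact hw h4

/-- Below the top, nodes of the stack do not change if the top is not done. -/
lemma IsStack.stat_succ {t : ℕ} {l : List V} : ∀ {a : V}, IsStack N r (stat k φ N r t) a l →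
    stat k φ N r t a ≠ .done → ∀ u ∈ l, stat k φ N r (t + 1) u = stat k φ N r t u := by
  induction l with
  | nil => intro a _ _ u hu; simp at hu
  | cons b l ih =>
    rintro a ⟨h1, _, h3⟩ ha u hu
    rcases List.mem_cons.1 hu with rfl | hu
    · exact stat_succ_of_calls h1 ha
    · obtain ⟨p, q, hb, _⟩ := h1
      exact ih h3 (by simp [hb]) u hu

/-! ### Progress and end of the traversal -/

/-- The rank of a status; it grows along the traversal. -/
def Status.rank : Status D k → ℕ
  | .fresh => 0
  | .hold i => i + 1
  -- Probes and calls interleave: probing `j`, calling at `j`, probing `j + 1` have increasing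
  -- ranks, above all waiting states.
  | .probe j => 3 * k + 4 + 2 * j
  | .call p => 3 * k + 5 + 2 * p
  | .done => 3 * k + 5 + 2 * D

lemma Status.rank_le (s : Status D k) : s.rank ≤ 3 * k + 5 + 2 * D := by
  cases s <;> simp only [Status.rank] <;> omega

lemma rank_stat_succ (t : ℕ) (v : V) :
    (stat k φ N r t v).rank ≤ (stat k φ N r (t + 1) v).rank ∧
      (stat k φ N r (t + 1) v ≠ stat k φ N r t v →
        (stat k φ N r t v).rank < (stat k φ N r (t + 1) v).rank) := by
  classical
  suffices stat k φ N r (t + 1) v = stat k φ N r t v ∨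
      (stat k φ N r t v).rank < (stat k φ N r (t + 1) v).rank by
    rcases this with h | h
    · simp [h]
    · exact ⟨h.le, fun _ => h⟩
  rcases h : stat k φ N r t v with _ | i | j | p | _
  · rw [stat_succ_of_fresh h]; split_ifs <;> simp [Status.rank]
  · rw [stat_succ_of_hold h]; split_ifs <;> simp [Status.rank]
  · rw [stat_succ_of_probe h]; split_ifs <;> (simp [Status.rank]; try omega)
  · rw [stat_succ_of_call h]
    split_ifs
    · right; simp only [Status.rank, Fin.val_succ]; omega
    · exact Or.inl rfl
  · rw [stat_succ_of_done h]; simp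

/-- One round of the traversal: the invariant is kept, and some status changes unless the requesting
node is done. -/
lemma StackInv.succ {t : ℕ} {a : V} {l : List V} (h : StackInv N r (stat k φ N r t) a l) :
    (∃ a' l', StackInv N r (stat k φ N r (t + 1)) a' l') ∧
      (stat k φ N r t r = .done ∨ ∃ u, stat k φ N r (t + 1) u ≠ stat k φ N r t u) := by
  classical
  by_cases hdone : stat k φ N r t a = .done
  · cases l with
    | nil =>
      have har : a = r := h.stack
      subst har
      have hsame : ∀ u, stat k φ N a (t + 1) u = stat k φ N a t u := by
        intro u
        by_cases hu : u ∈ [a]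
        · rw [List.mem_singleton.1 hu, hdone, stat_succ_of_done hdone]
        · exact h.stat_succ_outside hu
      refine ⟨⟨a, [], ?_⟩, Or.inl hdone⟩
      rw [funext hsame]
      exact h
    | cons b l =>
      -- Pop: the parent `b` sees that its child is done and becomes the top.
      obtain ⟨⟨p, q, hb, hp⟩, hab, hl⟩ := h.stack
      have hb' : stat k φ N r (t + 1) b = .probe p.succ := by
        rw [stat_succ_of_call hb, if_pos ⟨a, q, hp, hdone⟩]
      have hl' := hl.stat_succ (by simp [hb])
      refine ⟨⟨b, l, hl.congr hl', ?_, by simp [hb']⟩, Or.inr ⟨b, by simp [hb, hb']⟩⟩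
      intro u hu
      by_cases hua : u = a
      · subst hua; right; exact stat_succ_of_done hdone
      · have hu' : u ∉ a :: b :: l := by simpa [hua] using hu
        rw [h.stat_succ_outside hu']
        exact h.outside u hu'
  · have hl := h.stack.stat_succ hdone
    have hout : ∀ u ∉ a :: l, stat k φ N r (t + 1) u = .fresh ∨ stat k φ N r (t + 1) u = .done :=
      fun u hu => by rw [h.stat_succ_outside hu]; exact h.outside u hu
    have same : (∀ p, stat k φ N r (t + 1) a ≠ .call p) →
        ∃ a' l', StackInv N r (stat k φ N r (t + 1)) a' l' :=
      fun hp => ⟨a, l, h.stack.congr hl, hout, hp⟩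
    rcases ha : stat k φ N r t a with _ | i | j | p | _
    · have ha' : stat k φ N r (t + 1) a = .hold 0 := by
        rw [stat_succ_of_fresh ha, if_pos]
        cases l with
        | nil => exact Or.inl h.stack
        | cons b l => exact Or.inr ⟨b, h.stack.1⟩
      exact ⟨same (by simp [ha']), Or.inr ⟨a, by simp [ha, ha']⟩⟩
    · have ha' := stat_succ_of_hold ha
      refine ⟨same ?_, Or.inr ⟨a, ?_⟩⟩
      · rw [ha']; split_ifs <;> simp
      · rw [ha', ha]; split_ifs
        · intro h; injection h with h; simp [Fin.ext_iff] at h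
        · simp
    · have ha' := stat_succ_of_probe ha
      split_ifs at ha' with h1 h2
      -- Push: `w` is fresh, whereas the top is probing and the others on the stack are calling, so
      -- `w` is not yet on it.
      · obtain ⟨w, q, hw, hwf⟩ := h2
        have hwl : w ∉ a :: l := by
          intro hw'
          rcases List.mem_cons.1 hw' with rfl | hw'
          · simp [ha] at hwf
          · obtain ⟨_, _, p, q, hp, _⟩ := h.stack.exists_calls w hw'
            simp [hp] at hwf
        refine ⟨⟨w, a :: l, ⟨⟨_, q, ha', hw⟩, hwl, h.stack.congr hl⟩, ?_, ?_⟩,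
          Or.inr ⟨a, by simp [ha, ha']⟩⟩
        · intro u hu
          exact hout u fun h => hu (List.mem_cons_of_mem _ h)
        · rw [h.stat_succ_outside hwl, hwf]; simp
      · refine ⟨same (by simp [ha']), Or.inr ⟨a, ?_⟩⟩
        rw [ha', ha]
        intro h; injection h with h; simp [Fin.ext_iff] at h
      · exact ⟨same (by simp [ha']), Or.inr ⟨a, by simp [ha, ha']⟩⟩
    · exact absurd ha (h.top p)
    · exact absurd ha hdone

lemma exists_stackInv (t : ℕ) : ∃ a l, StackInv N r (stat k φ N r t) a l := by
  induction t with
  | zero =>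
    exact ⟨r, [], rfl, fun u _ => Or.inl (stat_zero u), fun p => by simp [stat_zero]⟩
  | succ t ih =>
    obtain ⟨a, l, h⟩ := ih
    exact h.succ.1

/-- At most one node is in its waiting time. -/
lemma hold_unique {t : ℕ} {u v : V} {i j} (hu : stat k φ N r t u = .hold i)
    (hv : stat k φ N r t v = .hold j) : u = v := by
  obtain ⟨a, l, h⟩ := exists_stackInv (k := k) (φ := φ) (N := N) (r := r) t
  have key : ∀ {w i}, stat k φ N r t w = .hold i → w = a := by
    intro w i hw
    by_contra hwa
    by_cases hwl : w ∈ l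
    · obtain ⟨_, _, p, q, hp, _⟩ := h.stack.exists_calls w hwl
      simp [hp] at hw
    · rcases h.outside w (by simp [hwa, hwl]) with h' | h' <;> simp [h'] at hw
  rw [key hu, key hv]

/-- The number of ports that have been inspected. -/
def Status.progress : Status D k → ℕ
  | .fresh => 0
  | .hold _ => 0
  | .probe j => j
  | .call p => p
  | .done => D

lemma stat_not_fresh_mono {t : ℕ} {v : V} (h : stat k φ N r t v ≠ .fresh) :
    stat k φ N r (t + 1) v ≠ .fresh := by
  have h1 := (rank_stat_succ (φ := φ) (N := N) (r := r) (k := k) t v).1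
  intro h2
  rw [h2] at h1
  apply h
  rcases hs : stat k φ N r t v with _ | i | j | p | _
  · rfl
  all_goals (rw [hs] at h1; simp [Status.rank] at h1)

/-- A port is passed only when the neighbor behind it was seen not to be fresh, or when the child
called there is done; and no node becomes fresh again. -/
lemma progress_not_fresh (t : ℕ) : ∀ (v : V) (p : Fin D) (w : V) (q : Fin D),
    N.port v p = some (w, q) → (p : ℕ) < (stat k φ N r t v).progress →
    stat k φ N r t w ≠ .fresh := by
  classical
  induction t with
  | zero => intro v p w q _ h; simp [stat_zero, Status.progress] at h
  | succ t ih =>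
    intro v p w q hp h
    by_cases h' : (p : ℕ) < (stat k φ N r t v).progress
    · exact stat_not_fresh_mono (ih v p w q hp h')
    rcases hs : stat k φ N r t v with _ | i | j | p' | _
    · rw [stat_succ_of_fresh hs] at h
      split_ifs at h <;> simp [Status.progress] at h
    · rw [stat_succ_of_hold hs] at h
      split_ifs at h <;> simp [Status.progress] at h
    · rw [stat_succ_of_probe hs] at h
      rw [hs] at h'
      split_ifs at h with h1 h2
      · simp [Status.progress] at h h'; omega
      · simp only [Status.progress] at h h'
        have hpj : p = ⟨j, h1⟩ := Fin.ext (by simp; omega)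
        subst hpj
        exact stat_not_fresh_mono fun hf => h2 ⟨w, q, hp, hf⟩
      · simp [Status.progress] at h h'; omega
    · rw [stat_succ_of_call hs] at h
      rw [hs] at h'
      split_ifs at h with h1
      · simp only [Status.progress, Fin.val_succ] at h h'
        have hpj : p = p' := Fin.ext (by omega)
        subst hpj
        obtain ⟨w', q', h2, h3⟩ := h1
        rw [hp] at h2
        cases h2
        exact stat_not_fresh_mono (by simp [h3])
      · exact absurd h h'
    · rw [hs] at h'
      exact absurd p.2 h'

/-- When the requesting node is done, all nodes are done. -/
lemma all_done {t : ℕ} (h : stat k φ N r t r = .done) (v : V) : stat k φ N r t v = .done := by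
  obtain ⟨a, l, hs⟩ := exists_stackInv (k := k) (φ := φ) (N := N) (r := r) t
  have hrl : r ∉ l := by
    intro hl
    obtain ⟨_, _, p, q, hp, _⟩ := hs.stack.exists_calls r hl
    simp [hp] at h
  have har : r = a := (List.mem_cons.1 hs.stack.root_mem).resolve_right hrl
  have hl : l = [] := by
    cases l with
    | nil => rfl
    | cons b l => exact absurd hs.stack.2.2.root_mem hrl
  subst hl har
  -- The stack consists of `r` alone, so visited nodes are done. As all neighbors of a done node are
  -- visited, doneness spreads along walks.
  have hfd : ∀ u, stat k φ N r t u ≠ .fresh → stat k φ N r t u = .done := by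
    intro u hu
    by_cases hur : u = r
    · rw [hur, h]
    · exact (hs.outside u (by simp [hur])).resolve_left hu
  obtain ⟨p⟩ := N.connected.preconnected r v
  suffices ∀ u w (_ : N.graph.Walk u w), stat k φ N r t u = .done → stat k φ N r t w = .done from
    this r v p h
  intro u w p
  induction p with
  | nil => exact id
  | cons hadj _ ih =>
    intro hu
    refine ih (hfd _ ?_)
    obtain ⟨p, q, hpq⟩ := (N.adj_iff _ _).1 hadj
    exact progress_not_fresh t _ p _ q hpq (by rw [hu]; exact p.2)

/-- The traversal ends after linearly many rounds. -/
lemma exists_done [Fintype V] :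
    ∃ t ≤ (3 * k + 5 + 2 * D) * Fintype.card V, stat k φ N r t r = .done := by
  by_contra! hne
  -- Until the end, each round raises the sum of the ranks by at least one.
  have key : ∀ t ≤ (3 * k + 5 + 2 * D) * Fintype.card V + 1,
      t ≤ ∑ v, (stat k φ N r t v).rank := by
    intro t
    induction t with
    | zero => intro _; exact Nat.zero_le _
    | succ t ih =>
      intro ht
      obtain ⟨a, l, hs⟩ := exists_stackInv (k := k) (φ := φ) (N := N) (r := r) t
      obtain ⟨u, hu⟩ := hs.succ.2.resolve_left (hne t (by omega))
      have := Finset.sum_lt_sum (s := Finset.univ) (fun v _ => (rank_stat_succ t v).1)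
        ⟨u, Finset.mem_univ u, (rank_stat_succ (φ := φ) (N := N) (r := r) t u).2 hu⟩
      have := ih (by omega)
      omega
  have h1 := key _ le_rfl
  have h2 : ∑ v, (stat k φ N r ((3 * k + 5 + 2 * D) * Fintype.card V + 1) v).rank ≤
      ∑ _v : V, (3 * k + 5 + 2 * D) := Finset.sum_le_sum fun v _ => Status.rank_le _
  simp only [Finset.sum_const, Finset.card_univ, smul_eq_mul] at h2
  rw [mul_comm (Fintype.card V)] at h2
  omega

/-! ### The coloring -/

lemma col_succ_eq {t : ℕ} {v : V} (h : stat k φ N r t v ≠ .hold (Fin.last (3 * k + 2))) :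
    (st k φ N r (t + 1) v).col = (st k φ N r t v).col := by
  rw [st_succ]
  exact if_neg fun h' => h h'.2

/-- No color changes while a node waits. -/
lemma col_eq_of_hold (t : ℕ) : ∀ (v : V) (i), stat k φ N r t v = .hold i →
    ∃ s, s + i = t ∧ ∀ u, (st k φ N r t u).col = (st k φ N r s u).col := by
  classical
  induction t with
  | zero => intro v i h; simp [stat_zero] at h
  | succ t ih =>
    intro v i h
    rcases hs : stat k φ N r t v with _ | j | j | p' | _
    · rw [stat_succ_of_fresh hs] at h
      split_ifs at h
      injection h with h
      exact ⟨t + 1, by simp [← h], fun _ => rfl⟩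
    · rw [stat_succ_of_hold hs] at h
      split_ifs at h with hj
      injection h with h
      obtain ⟨s, h1, h2⟩ := ih v j hs
      refine ⟨s, by rw [← h]; simp; omega, fun u => ?_⟩
      rw [col_succ_eq, h2]
      intro hu
      have := hold_unique hu hs
      subst this
      rw [hs] at hu
      injection hu with hu
      rw [hu] at hj
      simp at hj
    · rw [stat_succ_of_probe hs] at h; split_ifs at h
    · rw [stat_succ_of_call hs] at h; split_ifs at h
    · rw [stat_succ_of_done hs] at h; simp at h

lemma col_of_node_mem (t : ℕ) (v : V) (c : Color D k) (h : Atom.node c ∈ (st k φ N r t v).know 0) :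
    (st k φ N r t v).col = some c := by
  induction t with
  | zero => rw [st_zero] at h; exact h.elim
  | succ t ih =>
    rcases (know_zero_succ t v _).1 h with h | h
    · exact col_succ (ih h)
    · cases h with
      | node _ h => exact col_succ h

/-- If all colors were known, choosing for each a trace of length at most `3k + 1` to a node
carrying it would inject the colors into these traces. -/
lemma pickColor_spec (t : ℕ) (v : V) :
    Atom.node (pickColor ((st k φ N r t v).know (Fin.last (3 * k + 1)))) ∉
      (st k φ N r t v).know (Fin.last (3 * k + 1)) := by
  classical
  have hex : ∃ c, Atom.node c ∉ (st k φ N r t v).know (Fin.last (3 * k + 1)) := by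
    by_contra! hall
    have hsurj : ∀ c : Color D k, ∃ l : {l : List (Fin D) // l.length ≤ 3 * k + 1},
        ∃ w, N.follow v l = some w ∧ (st k φ N r t w).col = some c := by
      intro c
      obtain ⟨w, s, h1, h2, h3⟩ := exists_of_know t v _ _ (hall c)
      obtain ⟨l, hl, hf⟩ := exists_follow (3 * k + 1) v w h1
      exact ⟨⟨l, hl⟩, w, hf, col_mono (by omega) (col_of_node_mem s w c h3)⟩
    choose f w hf hc using hsurj
    have hinj : Function.Injective f := by
      intro c c' h
      have h1 := hf c
      rw [h, hf c'] at h1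
      have h2 := hc c
      rw [← Option.some.inj h1, hc c'] at h2
      exact (Option.some.inj h2).symm
    -- The `Option` in `Color` provides exactly one color more than there are traces.
    have := Nat.card_le_card_of_injective f hinj
    rw [Finite.card_option] at this
    omega
  unfold pickColor
  rw [dif_pos hex]
  exact hex.choose_spec

/-- Nodes at distance at most `3k + 1` have different colors. -/
lemma col_ne (t : ℕ) : ∀ (u v : V) (c : Color D k), u ≠ v → N.graph.dist u v ≤ 3 * k + 1 →
    (st k φ N r t u).col = some c → (st k φ N r t v).col ≠ some c := by
  induction t with
  | zero => intro u v c _ _ h; rw [st_zero] at h; simp [NodeState.init] at h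
  | succ t ih =>
    -- The case where `u` obtains `c` in this very round: `v` had its color throughout the waiting
    -- time of `u`, so `u` knows it and avoids it.
    have fresh_color : ∀ (u v : V) (c : Color D k), u ≠ v → N.graph.dist u v ≤ 3 * k + 1 →
        (st k φ N r (t + 1) u).col = some c → (st k φ N r t u).col ≠ some c →
        (st k φ N r (t + 1) v).col ≠ some c := by
      intro u v c huv hd hu hu' hv
      have hhold : stat k φ N r t u = .hold (Fin.last (3 * k + 2)) := by
        by_contra hne
        rw [col_succ_eq hne] at hu
        exact hu' hu
      rw [col_succ_eq fun h => huv (hold_unique hhold h)] at hv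
      obtain ⟨s, hs, hcol⟩ := col_eq_of_hold t u _ hhold
      rw [hcol] at hv
      have h1 : Atom.node c ∈ (st k φ N r (s + 1) v).know 0 :=
        (know_zero_succ s v _).2 (Or.inr (.node c hv))
      have h2 := know_of_dist_le (3 * k + 1) (by omega) (s + 1) u v hd h1
      have h3 : Atom.node c ∈ (st k φ N r t u).know (Fin.last (3 * k + 1)) :=
        know_mono (by simp at hs; omega) u _ h2
      have hc : c = pickColor ((st k φ N r t u).know (Fin.last (3 * k + 1))) := by
        rw [st_succ] at hu
        change NodeState.nextCol _ = _ at hu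
        unfold NodeState.nextCol at hu
        split_ifs at hu with h
        · exact (Option.some.inj hu).symm
        · exact absurd hu hu'
      rw [hc] at h3
      exact pickColor_spec t u h3
    intro u v c huv hd hu hv
    by_cases hu' : (st k φ N r t u).col = some c
    · by_cases hv' : (st k φ N r t v).col = some c
      · exact ih u v c huv hd hu' hv'
      · exact fresh_color v u c huv.symm (by rwa [SimpleGraph.dist_comm]) hv hv' hu
    · exact fresh_color u v c huv hd hu hu' hv

/-- A node leaves its waiting time only by the step that colors it, so a node that is neither fresh
nor waiting has a color. -/
lemma exists_col_of_done (t : ℕ) (v : V) (h : stat k φ N r t v = .done) :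
    ∃ c, (st k φ N r t v).col = some c := by
  classical
  suffices ∀ t, stat k φ N r t v = .fresh ∨ (∃ i, stat k φ N r t v = .hold i) ∨
      ∃ c, (st k φ N r t v).col = some c by
    rcases this t with h' | ⟨i, h'⟩ | h'
    · simp [h] at h'
    · simp [h] at h'
    · exact h'
  clear h t
  intro t
  induction t with
  | zero => exact Or.inl (stat_zero v)
  | succ t ih =>
    rcases ih with h | ⟨i, h⟩ | ⟨c, h⟩
    · rw [stat_succ_of_fresh h]
      split_ifs
      · exact Or.inr (Or.inl ⟨0, rfl⟩)
      · exact Or.inl rfl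
    · right
      by_cases hi : (i : ℕ) < 3 * k + 2
      · left; rw [stat_succ_of_hold h, dif_pos hi]; exact ⟨_, rfl⟩
      · right
        have hi' : i = Fin.last (3 * k + 2) := Fin.ext (by simp; omega)
        subst hi'
        rw [st_succ]
        change ∃ c, NodeState.nextCol _ = _
        unfold NodeState.nextCol
        split_ifs with h'
        · exact ⟨_, rfl⟩
        · rw [← Option.isSome_iff_exists, ← Option.ne_none_iff_isSome]
          exact fun h'' => h' ⟨h'', h⟩
    · exact Or.inr (Or.inr ⟨c, col_succ h⟩)

end Traversal

/-! ### Synchronization and evaluation of the stages -/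

section Stages

variable {D ℓ k : ℕ} {V : Type} {φ : Form ℓ} {N : Network D V} {r : V}

variable (k φ N r) in
/-- The traversal ends in round `T`, and `κ` is the resulting coloring. -/
structure Colored (T : ℕ) (κ : V → Color D k) : Prop where
  done : stat k φ N r T r = .done
  not_done : ∀ t < T, stat k φ N r t r ≠ .done
  col : ∀ v, (st k φ N r T v).col = some (κ v)

lemma exists_colored [Fintype V] :
    ∃ T κ, T ≤ (3 * k + 5 + 2 * D) * Fintype.card V ∧ Colored k φ N r T κ := by
  classical
  have hex : ∃ t, stat k φ N r t r = .done := by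
    obtain ⟨t, _, h⟩ := exists_done (k := k) (φ := φ) (N := N) (r := r)
    exact ⟨t, h⟩
  choose κ hκ using fun v => exists_col_of_done _ v (all_done (Nat.find_spec hex) v)
  refine ⟨Nat.find hex, κ, ?_, Nat.find_spec hex, fun t ht => Nat.find_min hex ht, hκ⟩
  obtain ⟨t, ht, h⟩ := exists_done (k := k) (φ := φ) (N := N) (r := r)
  exact (Nat.find_min' hex h).trans ht

namespace Colored

variable {T : ℕ} {κ : V → Color D k} (h : Colored k φ N r T κ)

include h

lemma col_eq {t : ℕ} (ht : T ≤ t) (v : V) : (st k φ N r t v).col = some (κ v) :=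
  col_mono ht (h.col v)

lemma eq_of_col {t : ℕ} {v : V} {c : Color D k} (hc : (st k φ N r t v).col = some c) : c = κ v := by
  have h1 := col_mono (le_max_left t T) hc
  rw [h.col_eq (le_max_right t T)] at h1
  exact (Option.some.inj h1).symm

lemma eq_of_color_eq {u v : V} (hd : N.graph.dist u v ≤ 3 * k + 1) (huv : κ u = κ v) : u = v := by
  by_contra hne
  exact col_ne T u v (κ u) hne hd (h.col u) (huv ▸ h.col v)

lemma stat_eq {t : ℕ} (ht : T ≤ t) (v : V) : stat k φ N r t v = .done :=
  stat_done_mono ht (all_done h.done v)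

/-- The requesting node raises the signal one round after `T`, which is the first round where it is
done; the signal then spreads one edge per round. -/
lemma go_iff (t : ℕ) : ∀ v, (st k φ N r t v).go ↔ T + 1 + N.graph.dist r v ≤ t := by
  induction t with
  | zero =>
    intro v
    rw [st_zero]
    simp [NodeState.init]
  | succ t ih =>
    intro v
    rw [st_succ]
    change ((st k φ N r t v).go ∨ ((st k φ N r t v).req ∧ stat k φ N r t v = .done) ∨
      ∃ p e, vw k φ N r t v p = some e ∧ e.go) ↔ _
    simp only [exists_vw (fun e => e.go), st_req]
    constructor
    · rintro (h1 | ⟨rfl, h1⟩ | ⟨p, w, q, hp, h1⟩)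
      · have := (ih v).1 h1; omega
      · have : ¬ t < T := fun ht => h.not_done t ht h1
        simp; omega
      · have h2 := (ih w).1 h1
        have h3 := N.connected.dist_triangle (u := r) (v := w) (w := v)
        have h4 := SimpleGraph.dist_eq_one_iff_adj.2 ((N.adj_iff v w).2 ⟨p, q, hp⟩)
        rw [SimpleGraph.dist_comm] at h4
        omega
    · intro h1
      rcases hd : N.graph.dist r v with _ | d
      · have hv : r = v := N.connected.dist_eq_zero_iff.1 hd
        subst hv
        exact Or.inr (Or.inl ⟨rfl, h.stat_eq (by omega) _⟩)
      · obtain ⟨w, hw, hwv⟩ := (dist_le_succ_iff N.connected r v d).1 hd.le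
        rcases hwv with rfl | hadj
        · omega
        · obtain ⟨p, q, hp⟩ := (N.adj_iff v w).1 hadj.symm
          exact Or.inr (Or.inr ⟨p, w, q, hp, (ih w).2 (by omega)⟩)

/-- Truncated subtraction gives zero as long as the signal has not arrived. -/
lemma clock_eq (t : ℕ) (v : V) :
    ((st k φ N r t v).clock : ℕ) = (t - (T + 1 + N.graph.dist r v)) % (2 * k + 1) := by
  classical
  induction t with
  | zero => rw [st_zero]; simp [NodeState.init]
  | succ t ih =>
    rw [st_succ]
    simp only [NodeState.next]
    split_ifs with hgo
    · have := (h.go_iff t v).1 hgo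
      rw [Fin.val_add, ih, Fin.val_one', ← Nat.add_mod]
      congr 1
      omega
    · rw [h.go_iff t v] at hgo
      rw [ih]
      congr 1
      omega

lemma node_mem {t : ℕ} {v : V} {c : Color D k} (hc : Atom.node c ∈ (st k φ N r t v).know 0) :
    c = κ v :=
  h.eq_of_col (col_of_node_mem t v c hc)

lemma mem_node {t : ℕ} (ht : T + 1 ≤ t) (v : V) : Atom.node (κ v) ∈ (st k φ N r t v).know 0 :=
  know_mono ht v 0 ((know_zero_succ T v _).2 (Or.inr (.node _ (h.col v))))

lemma req_mem {t : ℕ} {v : V} {c : Color D k} (hc : Atom.req c ∈ (st k φ N r t v).know 0) :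
    v = r ∧ c = κ v := by
  induction t with
  | zero => rw [st_zero] at hc; exact hc.elim
  | succ t ih =>
    rcases (know_zero_succ t v _).1 hc with h' | h'
    · exact ih h'
    · cases h' with
      | req _ h1 h2 => exact ⟨(st_req t v).1 h2, h.eq_of_col h1⟩

lemma mem_req {t : ℕ} (ht : T + 1 ≤ t) : Atom.req (κ r) ∈ (st k φ N r t r).know 0 :=
  know_mono ht r 0 ((know_zero_succ T r _).2 (Or.inr (.req _ (h.col r) ((st_req T r).2 rfl))))

lemma adj_mem {t : ℕ} {v : V} {c c' : Color D k} {p : Fin D}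
    (hc : Atom.adj c p c' ∈ (st k φ N r t v).know 0) :
    c = κ v ∧ ∃ w q, N.port v p = some (w, q) ∧ c' = κ w := by
  induction t with
  | zero => rw [st_zero] at hc; exact hc.elim
  | succ t ih =>
    rcases (know_zero_succ t v _).1 hc with h' | h'
    · exact ih h'
    · cases h' with
      | adj _ _ _ e h1 h2 h3 =>
        obtain ⟨w, q, hp, rfl⟩ := vw_eq_some.1 h2
        exact ⟨h.eq_of_col h1, w, q, hp, h.eq_of_col h3⟩

lemma mem_adj {t : ℕ} (ht : T + 1 ≤ t) {v w : V} {p q : Fin D} (hp : N.port v p = some (w, q)) :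
    Atom.adj (κ v) p (κ w) ∈ (st k φ N r t v).know 0 :=
  know_mono ht v 0 ((know_zero_succ T v _).2
    (Or.inr (.adj _ _ _ _ (h.col v) (vw_eq_some.2 ⟨w, q, hp, rfl⟩) (h.col w))))

omit h in
lemma mem_radius {t : ℕ} {v w : V} (hd : N.graph.dist v w ≤ k) {a : Atom D ℓ (Color D k)}
    {s : ℕ} (hs : s + N.graph.dist v w ≤ t) (ha : a ∈ (st k φ N r s w).know 0) :
    a ∈ (st k φ N r t v).know (radius k) :=
  know_mono hs v _ (know_of_dist_le k (by omega) s v w hd ha)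

lemma node_mem_radius_iff {t : ℕ} (ht : T + 1 + k ≤ t) (v : V) (c : Color D k) :
    Atom.node c ∈ (st k φ N r t v).know (radius k) ↔ ∃ w, N.graph.dist v w ≤ k ∧ κ w = c := by
  constructor
  · intro hc
    obtain ⟨w, s, h1, _, h3⟩ := exists_of_know t v _ _ hc
    exact ⟨w, h1, (h.node_mem h3).symm⟩
  · rintro ⟨w, h1, rfl⟩
    exact mem_radius h1 (by omega) (h.mem_node le_rfl w)

/-- The source of the atom lies in the `k`-ball of `v` and has the color of `u`; being within `2k`
of `u`, it is `u`. -/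
lemma adj_mem_radius {t : ℕ} {v u : V} (hu : N.graph.dist v u ≤ k) {p : Fin D} {c : Color D k}
    (hc : Atom.adj (κ u) p c ∈ (st k φ N r t v).know (radius k)) :
    ∃ w q, N.port u p = some (w, q) ∧ c = κ w := by
  obtain ⟨z, s, h1, _, h3⟩ := exists_of_know t v _ _ hc
  obtain ⟨h4, h5⟩ := h.adj_mem h3
  have h6 := N.connected.dist_triangle (u := u) (v := v) (w := z)
  rw [SimpleGraph.dist_comm (u := u) (v := v)] at h6
  change N.graph.dist v z ≤ k at h1
  have : u = z := h.eq_of_color_eq (by omega) h4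
  rwa [this]

/-- The atoms in the knowledge of `v` evaluate the local formula correctly. -/
lemma eval_iff {t : ℕ} (ht : T + 1 + k ≤ t) {v : V} {I : Set (Fin (ℓ + 1) → V)}
    (hI : ∀ a ∈ I, ∀ i, N.graph.dist (a 0) (a i) ≤ k)
    (hrel : ∀ b, Atom.rel b ∈ (st k φ N r t v).know (radius k) ↔
      ∃ a ∈ I, N.graph.dist v (a 0) ≤ k ∧ b = κ ∘ a)
    (b : Fin (ℓ + 1) → Color D k) (hb : b 0 = κ v) :
    Eval φ ((st k φ N r t v).know (radius k)) b ↔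
      ∃ a, a 0 = v ∧ b = κ ∘ a ∧ Sat N.graph r I (localize k φ) a := by
  set K := (st k φ N r t v).know (radius k) with hK
  have hball : {c | Atom.node c ∈ K} = κ '' {z | N.graph.dist v z ≤ k} := by
    ext c; exact h.node_mem_radius_iff ht v c
  have htri : ∀ {u w}, N.graph.dist v u ≤ k → N.graph.dist u w ≤ N.graph.dist v w + k := by
    intro u w hu
    have := N.connected.dist_triangle (u := u) (v := v) (w := w)
    rw [SimpleGraph.dist_comm (u := u) (v := v)] at this
    omega
  -- On the ball, `κ` is an embedding into the structure described by the atoms, so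
  -- `satIn_image_iff` applies.
  have key : ∀ a : Fin (ℓ + 1) → V, a 0 = v → (∀ i, N.graph.dist v (a i) ≤ k) →
      ((letI := interp N.graph r I; SatIn {z | N.graph.dist v z ≤ k} φ a default) ↔
        (letI := relStructure (ℓ := ℓ) (fun c c' => ∃ p, Atom.adj c p c' ∈ K)
          (fun c => Atom.req c ∈ K) {b | Atom.rel b ∈ K}
        SatIn {c | Atom.node c ∈ K} φ (κ ∘ a) default)) := by
    intro a _ ha
    rw [hball, ← Subsingleton.elim (κ ∘ (default : Fin 0 → V)) default]
    refine satIn_image_iff κ _ ?_ ?_ ?_ ?_ φ a ha default (fun i => i.elim0)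
    · intro u (hu : _ ≤ k) w (hw : _ ≤ k) huw
      have := htri (w := w) hu
      exact h.eq_of_color_eq (by omega) huw
    · intro u (hu : _ ≤ k) w (hw : _ ≤ k)
      rw [N.adj_iff]
      constructor
      · rintro ⟨p, q, hp⟩
        exact ⟨p, mem_radius hu (by omega) (h.mem_adj le_rfl hp)⟩
      · rintro ⟨p, hp⟩
        obtain ⟨w', q, hq, hw'⟩ := h.adj_mem_radius hu hp
        have h1 := SimpleGraph.dist_eq_one_iff_adj.2 ((N.adj_iff u w').2 ⟨p, q, hq⟩)
        have h2 := N.connected.dist_triangle (u := w) (v := u) (w := w')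
        have h3 := htri (w := u) hw
        -- The neighbor `w'` of `u` may lie outside the ball, but it is within `2k + 1` of `w`.
        have : w = w' := h.eq_of_color_eq (by omega) hw'
        exact ⟨p, q, this ▸ hq⟩
    · intro u (hu : _ ≤ k)
      constructor
      · rintro rfl
        exact mem_radius hu (by omega) (h.mem_req le_rfl)
      · intro hreq
        obtain ⟨z, s, h1, _, h3⟩ := exists_of_know t v _ _ hreq
        obtain ⟨rfl, h5⟩ := h.req_mem h3
        have := htri (w := z) hu
        change N.graph.dist v z ≤ k at h1
        exact h.eq_of_color_eq (by omega) h5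
    · intro d hd
      rw [Set.mem_ofPred_eq, hrel]
      constructor
      · intro hdI
        exact ⟨d, hdI, hd 0, rfl⟩
      · rintro ⟨d', hd', hd0, heq⟩
        -- A known tuple only has its first entry in the ball; its other entries are within `2k` of
        -- `v`, hence within `3k` of those of `d`. This is why colors must separate nodes at such
        -- distances.
        have : d = d' := by
          funext i
          have h1 := hI d' hd' i
          have h2 := N.connected.dist_triangle (u := v) (v := d' 0) (w := d' i)
          have h3 := htri (w := d' i) (hd i)
          exact h.eq_of_color_eq (by omega) (congrFun heq i)
        exact this ▸ hd'
  constructor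
  · rintro ⟨h1, h2⟩
    choose a ha hab using fun i => (h.node_mem_radius_iff ht v (b i)).1 (h1 i)
    have hba : b = κ ∘ a := funext fun i => (hab i).symm
    have ha0 : a 0 = v := by
      refine (h.eq_of_color_eq ?_ ((hab 0).trans hb).symm).symm
      have := ha 0; omega
    refine ⟨a, ha0, hba, (sat_localize N.connected r I k φ a).2 ?_⟩
    rw [ha0]
    refine ⟨ha, (key a ha0 ha).2 ?_⟩
    rwa [← hba]
  · rintro ⟨a, ha0, rfl, hsat⟩
    have h1 := (sat_localize N.connected r I k φ a).1 hsat
    rw [ha0] at h1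
    exact ⟨fun i => (h.node_mem_radius_iff ht v _).2 ⟨a i, h1.1 i, rfl⟩, (key a ha0 h1.1).1 h1.2⟩

/-- The fixpoint tuples known to node `v` are those of the current stage by its local clock. -/
lemma rel_mem_iff (t : ℕ) : ∀ (v : V) (b : Fin (ℓ + 1) → Color D k),
    Atom.rel b ∈ (st k φ N r t v).know 0 ↔
      ∃ a ∈ stage N.graph r (localize k φ) ((t - (T + 1 + N.graph.dist r v)) / (2 * k + 1)),
        a 0 = v ∧ b = κ ∘ a := by
  -- Strong induction, because the tuples that `v` sees left their sources in various earlier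
  -- rounds.
  induction t using Nat.strong_induction_on with
  | _ t ih =>
  rcases t with _ | t
  · intro v b
    rw [st_zero]
    simp [NodeState.init, stage]
  intro v b
  rw [know_zero_succ, ih t (by omega) v b]
  set τ := T + 1 + N.graph.dist r v with hτ
  have hP : 0 < 2 * k + 1 := by omega
  have hdm := Nat.div_add_mod (t - τ) (2 * k + 1)
  have hml := Nat.mod_lt (t - τ) hP
  -- Only in the last round of a period of its clock can `v` add tuples, and only there does the
  -- stage index increase.
  by_cases htick : τ ≤ t ∧ (t - τ) % (2 * k + 1) = 2 * k
  · obtain ⟨hτt, hmod⟩ := htick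
    set i := (t - τ) / (2 * k + 1) with hi
    have hnext : (t + 1 - τ) / (2 * k + 1) = i + 1 := by
      have : t + 1 - τ = (2 * k + 1) * (i + 1) := by rw [mul_add]; omega
      rw [this, Nat.mul_div_cancel_left _ hP]
    have hrel : ∀ b, Atom.rel b ∈ (st k φ N r t v).know (radius k) ↔
        ∃ a ∈ stage N.graph r (localize k φ) i, N.graph.dist v (a 0) ≤ k ∧ b = κ ∘ a := by
      intro b
      constructor
      · intro hb
        obtain ⟨w, s, h1, h2, h3⟩ := exists_of_know t v _ _ hb
        obtain ⟨a, ha, rfl, rfl⟩ := (ih s (by omega) w b).1 h3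
        -- Not ahead: the travel time makes up for the earlier start that the source may have had.
        refine ⟨a, stage_mono _ (Nat.div_le_div_right ?_) ha, h1, rfl⟩
        have h4 := N.connected.dist_triangle (u := r) (v := a 0) (w := v)
        rw [SimpleGraph.dist_comm (u := a 0) (v := v)] at h4
        omega
      · rintro ⟨a, ha, h1, rfl⟩
        have h4 := N.connected.dist_triangle (u := r) (v := v) (w := a 0)
        have h6 := N.connected.dist_triangle (u := r) (v := a 0) (w := v)
        rw [SimpleGraph.dist_comm (u := a 0) (v := v)] at h6
        -- Not behind: at distance `d ≤ k` the source lost at most `d` rounds by a later start and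
        -- `d` by travel, and `2k` rounds of the current period have passed.
        refine mem_radius h1 (s := t - N.graph.dist v (a 0)) (by omega)
          ((ih _ (by omega) (a 0) _).2 ⟨a, stage_mono _ ?_ ha, rfl, rfl⟩)
        rw [Nat.le_div_iff_mul_le hP, mul_comm]
        omega
    have hown : (st k φ N r t v).OwnAtom φ (vw k φ N r t v) (.rel b) ↔
        b 0 = κ v ∧ Eval φ ((st k φ N r t v).know (radius k)) b := by
      constructor
      · intro h'
        cases h' with
        | rel _ h1 _ _ h4 => exact ⟨h.eq_of_col h1, h4⟩
      · rintro ⟨h1, h2⟩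
        refine .rel b ?_ ((h.go_iff t v).2 hτt) (Fin.ext ?_) h2
        · rw [h1]; exact h.col_eq (by omega) v
        · rw [h.clock_eq, hmod]; rfl
    have hev := h.eval_iff (t := t) (v := v) (by
      have : 2 * k ≤ t - τ := hmod ▸ Nat.mod_le _ _
      omega) (fun a ha => dist_le_of_mem_stage N.connected ha) hrel b
    rw [hown, hnext]
    constructor
    · rintro (⟨a, ha, h1, h2⟩ | ⟨h1, h2⟩)
      · exact ⟨a, Or.inr ha, h1, h2⟩
      · obtain ⟨a, h3, h4, h5⟩ := (hev h1).1 h2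
        exact ⟨a, Or.inl h5, h3, h4⟩
    · rintro ⟨a, ha | ha, h1, h2⟩
      · right
        have hb0 : b 0 = κ v := by rw [h2, Function.comp, h1]
        exact ⟨hb0, (hev hb0).2 ⟨a, h1, h2, ha⟩⟩
      · exact Or.inl ⟨a, ha, h1, h2⟩
  · have hnext : (t + 1 - τ) / (2 * k + 1) = (t - τ) / (2 * k + 1) := by
      by_cases hτt : τ ≤ t
      · have hmod : (t - τ) % (2 * k + 1) ≠ 2 * k := fun h' => htick ⟨hτt, h'⟩
        refine Nat.div_eq_of_lt_le ?_ ?_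
        · rw [mul_comm]; omega
        · rw [mul_comm, mul_add]; omega
      · have h1 : t + 1 - τ = 0 := by omega
        have h2 : t - τ = 0 := by omega
        rw [h1, h2]
    rw [hnext, or_iff_left]
    intro h'
    cases h' with
    | rel _ _ h2 h3 _ =>
      refine htick ⟨(h.go_iff t v).1 h2, ?_⟩
      rw [← h.clock_eq, h3]; rfl

/-! ### The answers -/

/-- The budget `dist v u + l.length ≤ k` keeps the trace inside the ball, where adjacency atoms
determine their nodes. -/
lemma exists_follow_of_traceIn {t : ℕ} {v : V} {l : List (Fin D)} : ∀ {u : V} {c : Color D k},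
    N.graph.dist v u + l.length ≤ k → TraceIn ((st k φ N r t v).know (radius k)) (κ u) l c →
    ∃ w, N.follow u l = some w ∧ c = κ w ∧ N.graph.dist v w ≤ k := by
  induction l with
  | nil => rintro u c hu h1; exact ⟨u, rfl, h1.symm, by simpa using hu⟩
  | cons p l ih =>
    rintro u c hu ⟨c', h1, h2⟩
    rw [List.length_cons] at hu
    obtain ⟨w, q, hp, rfl⟩ := h.adj_mem_radius (by omega) h1
    have h3 := N.connected.dist_triangle (u := v) (v := u) (w := w)
    have h4 := SimpleGraph.dist_eq_one_iff_adj.2 ((N.adj_iff u w).2 ⟨p, q, hp⟩)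
    obtain ⟨z, h5, h6⟩ := ih (by omega) h2
    exact ⟨z, by simp [Network.follow, hp, h5], h6⟩

lemma traceIn_of_follow {t : ℕ} (ht : T + 1 + k ≤ t) {v w : V} {l : List (Fin D)} : ∀ {u : V},
    N.graph.dist v u + l.length ≤ k → N.follow u l = some w →
    TraceIn ((st k φ N r t v).know (radius k)) (κ u) l (κ w) := by
  induction l with
  | nil =>
    intro u _ h1
    cases h1
    rfl
  | cons p l ih =>
    intro u hu h1
    rw [List.length_cons] at hu
    simp only [Network.follow, Option.bind_eq_some_iff] at h1
    obtain ⟨⟨z, q⟩, hp, h2⟩ := h1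
    have h3 := N.connected.dist_triangle (u := v) (v := u) (w := z)
    have h4 := SimpleGraph.dist_eq_one_iff_adj.2 ((N.adj_iff u z).2 ⟨p, q, hp⟩)
    exact ⟨κ z, mem_radius (by omega) (by omega) (h.mem_adj le_rfl hp), ih (by omega) h2⟩

/-- The answers of `v` represent the current stage by its local clock. -/
lemma holds_answers {M : Machine D ℓ} {t : ℕ} (ht : T + 1 + k ≤ t) (v : V) (c : Config M)
    (hc : c.table = (st k φ N r t v).answers) :
    Holds N (stage N.graph r (localize k φ) ((t - (T + 1 + N.graph.dist r v)) / (2 * k + 1))) v c := by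
  unfold Holds
  rw [hc]
  constructor
  · rintro e ⟨b, hb, he⟩
    obtain ⟨a, ha, rfl, rfl⟩ := (h.rel_mem_iff t v b).1 hb
    refine ⟨fun i => a i.succ, fun i => ?_, ?_⟩
    · obtain ⟨w, h1, h2, h3⟩ := h.exists_follow_of_traceIn
        (by simpa using (he i).1) (he i).2
      -- The end of the trace and the entry of the tuple have the same color and are both within `k`
      -- of `v`, so they coincide.
      have h4 := dist_le_of_mem_stage N.connected ha i.succ
      have h5 := N.connected.dist_triangle (u := w) (v := a 0) (w := a i.succ)
      rw [SimpleGraph.dist_comm (u := w) (v := a 0)] at h5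
      rw [h1, h.eq_of_color_eq (by omega) h2.symm]
    · convert ha using 1
      exact Fin.cons_self_tail a
  · intro b hb
    have hd := dist_le_of_mem_stage N.connected hb
    have hex : ∀ i, ∃ l : List (Fin D), l.length ≤ k ∧ N.follow v l = some (b i) := by
      intro i
      have := hd i.succ
      simp only [Fin.cons_zero, Fin.cons_succ] at this
      exact exists_follow k v (b i) this
    choose e he hf using hex
    refine ⟨e, ⟨κ ∘ (Fin.cons v b : Fin (ℓ + 1) → V), (h.rel_mem_iff t v _).2 ⟨_, hb, rfl, rfl⟩,
      fun i => ⟨he i, ?_⟩⟩, hf⟩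
    exact h.traceIn_of_follow ht (by simpa using he i) (hf i)

/-! ### Termination -/

/-- The entries of a tuple are within `k` of the first one, so candidates for an entry are at most
`2k` apart and their colors tell them apart. -/
lemma ncard_stage_le [Fintype V] (n : ℕ) : (stage N.graph r (localize k φ) n).ncard ≤
    Fintype.card V * Nat.card (Fin ℓ → Color D k) := by
  have hinj : Set.InjOn (fun a : Fin (ℓ + 1) → V => (a 0, fun i : Fin ℓ => κ (a i.succ)))
      (stage N.graph r (localize k φ) n) := by
    intro a ha a' ha' heq
    simp only [Prod.mk.injEq] at heq
    obtain ⟨h0, h1⟩ := heq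
    funext i
    refine Fin.cases h0 (fun j => ?_) i
    have h2 := dist_le_of_mem_stage N.connected ha j.succ
    have h3 := dist_le_of_mem_stage N.connected ha' j.succ
    have h4 := N.connected.dist_triangle (u := a j.succ) (v := a 0) (w := a' j.succ)
    rw [SimpleGraph.dist_comm (u := a j.succ) (v := a 0)] at h4
    rw [← h0] at h3
    exact h.eq_of_color_eq (by omega) (congrFun h1 j)
  have := Set.ncard_le_ncard_of_injOn (t := Set.univ) _ (fun _ _ => Set.mem_univ _) hinj
    (Set.toFinite _)
  rwa [Set.ncard_univ, Nat.card_prod, Nat.card_eq_fintype_card] at this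

/-- Once the stages are stable, nodes learn nothing new about themselves. -/
lemma know_zero_stable [Fintype V] {t₁ : ℕ} (ht₁ : T + 1 ≤ t₁)
    (hst : ∀ v, Fintype.card V * Nat.card (Fin ℓ → Color D k) ≤
      (t₁ - (T + 1 + N.graph.dist r v)) / (2 * k + 1))
    (s : ℕ) (v : V) : (st k φ N r s v).know 0 ⊆ (st k φ N r t₁ v).know 0 := by
  rintro (c | c | ⟨c, p, c'⟩ | b) ha
  · rw [h.node_mem ha]; exact h.mem_node ht₁ v
  · obtain ⟨rfl, rfl⟩ := h.req_mem ha
    exact h.mem_req ht₁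
  · obtain ⟨rfl, w, q, hp, rfl⟩ := h.adj_mem ha
    exact h.mem_adj ht₁ hp
  · obtain ⟨a, h1, h2⟩ := (h.rel_mem_iff s v b).1 ha
    refine (h.rel_mem_iff t₁ v b).2 ⟨a, ?_, h2⟩
    rw [stage_eq_fixpoint h.ncard_stage_le (hst v)]
    exact Set.subset_iUnion _ _ h1

/-- From round `t₁` on no node has anything new to say about itself, and old atoms arrive everywhere
they can within `3k + 1` rounds. -/
lemma know_stable [Fintype V] {t₁ : ℕ} (ht₁ : T + 1 ≤ t₁)
    (hst : ∀ v, Fintype.card V * Nat.card (Fin ℓ → Color D k) ≤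
      (t₁ - (T + 1 + N.graph.dist r v)) / (2 * k + 1))
    {t : ℕ} (ht : t₁ + (3 * k + 1) ≤ t) (v : V) :
    (st k φ N r (t + 1) v).know = (st k φ N r t v).know := by
  funext j
  refine Set.Subset.antisymm (fun a ha => ?_) (know_succ_subset t v j)
  obtain ⟨w, s, h1, h2, h3⟩ := exists_of_know (t + 1) v j a ha
  have h4 := h.know_zero_stable ht₁ hst s w h3
  exact know_mono (by omega) v j (know_of_dist_le j j.2 t₁ v w h1 h4)

end Colored

/-! ### The number of messages -/

open Classical in
/-- A measure of the exposed part of a state that grows whenever an exposed value changes. -/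
noncomputable def NodeState.measure (s : NodeState D ℓ k) : ℕ :=
  s.status.rank + ∑ j, (s.know j).ncard + (if s.col = none then 0 else 1) + (if s.go then 1 else 0)

variable (D ℓ k) in
/-- A bound for the measure. -/
noncomputable def measureBound : ℕ :=
  3 * k + 5 + 2 * D + (3 * k + 2) * Nat.card (Atom D ℓ (Color D k)) + 2

lemma NodeState.measure_le (s : NodeState D ℓ k) : s.measure ≤ measureBound D ℓ k := by
  have h1 := s.status.rank_le
  have h2 : ∑ j, (s.know j).ncard ≤ ∑ _j : Fin (3 * k + 2), Nat.card (Atom D ℓ (Color D k)) :=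
    Finset.sum_le_sum fun j _ => Set.ncard_le_card _
  simp only [Finset.sum_const, Finset.card_univ, Fintype.card_fin, smul_eq_mul] at h2
  unfold measure measureBound
  split_ifs <;> omega

/-- Each summand is monotone in time, so equal sums force equal summands, and these determine
everything exposed: rank steps are strict, and nested finite sets of equal size coincide. -/
lemma measure_succ (t : ℕ) (v : V) :
    (st k φ N r t v).measure ≤ (st k φ N r (t + 1) v).measure ∧
      ((st k φ N r (t + 1) v).measure = (st k φ N r t v).measure →
        (st k φ N r (t + 1) v).expose = (st k φ N r t v).expose) := by
  classical
  have h1 := rank_stat_succ (k := k) (φ := φ) (N := N) (r := r) t v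
  unfold stat at h1
  have h2 : ∀ j ∈ Finset.univ, ((st k φ N r t v).know j).ncard ≤
      ((st k φ N r (t + 1) v).know j).ncard :=
    fun j _ => Set.ncard_le_ncard (know_succ_subset t v j)
  have h2' := Finset.sum_le_sum h2
  have h3 : (if (st k φ N r t v).col = none then 0 else 1) ≤
      (if (st k φ N r (t + 1) v).col = none then 0 else 1) := by
    rcases hc : (st k φ N r t v).col with _ | c
    · simp
    · simp [col_succ hc]
  have h4 : (if (st k φ N r t v).go then 1 else 0) ≤ (if (st k φ N r (t + 1) v).go then 1 else 0) := by
    by_cases hg : (st k φ N r t v).go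
    · simp [hg, go_mono t.le_succ hg]
    · simp [hg]
  unfold NodeState.measure
  refine ⟨by omega, fun heq => ?_⟩
  have e1 : (st k φ N r (t + 1) v).status = (st k φ N r t v).status := by
    by_contra hne
    have := h1.2 hne
    omega
  have e2 : (st k φ N r (t + 1) v).know = (st k φ N r t v).know := by
    have hsum : ∑ j, ((st k φ N r t v).know j).ncard = ∑ j, ((st k φ N r (t + 1) v).know j).ncard := by
      omega
    funext j
    have := (Finset.sum_eq_sum_iff_of_le h2).1 hsum j (Finset.mem_univ j)
    exact (Set.eq_of_subset_of_ncard_le (know_succ_subset t v j) this.ge).symm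
  have e3 : (st k φ N r (t + 1) v).col = (st k φ N r t v).col := by
    rcases hc : (st k φ N r t v).col with _ | c
    · by_contra hne
      simp only [hc, if_true, if_neg hne] at heq h3
      omega
    · exact col_succ hc
  have e4 : (st k φ N r (t + 1) v).go = (st k φ N r t v).go := by
    by_cases hg : (st k φ N r t v).go
    · simp [hg, go_mono t.le_succ hg]
    · by_cases hg' : (st k φ N r (t + 1) v).go
      · simp only [hg, hg', if_true, if_false] at heq
        omega
      · simp [hg, hg']
  funext q
  simp only [NodeState.expose, e1, e2, e3, e4]

end Stages

end DistFP

/-! ### Assembly of the complexity bounds -/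

theorem theorem9 (D ℓ : ℕ) (ψ : DistFP.Form ℓ) (hψ : DistFP.IsFPLoc ψ) :
    ∃ (M : DistFP.Machine D ℓ) (C : ℕ),
      ∀ (V : Type) [Fintype V] (N : DistFP.Network D V) (r : V),
        ∃ E : DistFP.Execution N M r,
          -- in-node time per round
          (∀ t v, E.time t v ≤ C) ∧
          -- message size
          (∀ t v p, ((E.post t v).outBuf p).length ≤ C) ∧
          -- messages per node
          (∀ v t, ∑ i ∈ Finset.range t, E.numSent i v ≤ C) ∧
          -- distributed time and correctness of the answer
          ∃ τ ≤ C * Fintype.card V,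
            E.TerminatedBy τ ∧
            ∀ v, DistFP.Holds N (DistFP.fixpoint N.graph r ψ) v (E.pre τ v) := by
  obtain ⟨k, φ, rfl⟩ := hψ
  open DistFP in
  set A := evaluator D k φ with hA
  set X := Nat.card (Fin ℓ → Color D k) with hX
  -- Rounds per node: the traversal, one for the start signal to be raised, one for it to spread,
  -- `X` stages of `2k + 1` rounds, and the final propagation of atoms.
  set B := (3 * k + 5 + 2 * D) + 1 + 1 + (2 * k + 1) * X + (3 * k + 1) with hB
  refine ⟨A.machine, (2 * A.width + 2) + D * measureBound D ℓ k + B, ?_⟩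
  intro V _ N r
  obtain ⟨E, htime, hlen, hsend, hpre, hpost⟩ := A.exists_execution N r
  have hrun : ∀ t v, A.run N r t v = st k φ N r t v := fun _ _ => rfl
  refine ⟨E, fun t v => (htime t v).trans (by omega), fun t v p => (hlen t v p).trans (by omega),
    ?_, ?_⟩
  · intro v t
    -- A round with messages sends at most `D` of them and raises the measure; the increments
    -- telescope.
    have hnum : ∀ i, E.numSent i v ≤
        D * ((st k φ N r (i + 1) v).measure - (st k φ N r i v).measure) := by
      intro i
      have hm := measure_succ (k := k) (φ := φ) (N := N) (r := r) i v
      by_cases heq : (st k φ N r (i + 1) v).measure = (st k φ N r i v).measure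
      · have : E.numSent i v = 0 := by
          unfold Execution.numSent
          rw [Finset.card_eq_zero, Finset.filter_eq_empty_iff]
          intro p _ hp
          exact hsend i v p hp (congrFun (hm.2 heq) p).symm
        rw [this]
        exact Nat.zero_le _
      · have h1 : E.numSent i v ≤ D := by
          unfold Execution.numSent
          exact (Finset.card_filter_le _ _).trans (by simp)
        have h2 : 1 ≤ (st k φ N r (i + 1) v).measure - (st k φ N r i v).measure := by omega
        exact h1.trans (Nat.le_mul_of_pos_right D h2)
    have hmono : Monotone fun i => (st k φ N r i v).measure :=
      monotone_nat_of_le_succ fun i => (measure_succ i v).1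
    have h1 : ∑ i ∈ Finset.range t, E.numSent i v ≤ D * measureBound D ℓ k := by
      refine (Finset.sum_le_sum fun i _ => hnum i).trans ?_
      rw [← Finset.mul_sum, Finset.sum_range_tsub hmono]
      exact Nat.mul_le_mul_left D ((Nat.sub_le _ _).trans (NodeState.measure_le _))
    omega
  · obtain ⟨T, κ, hT, h⟩ := exists_colored (k := k) (φ := φ) (N := N) (r := r)
    set n := Fintype.card V with hn
    have hn1 : 1 ≤ n := Fintype.card_pos_iff.2 ⟨r⟩
    have hdist : ∀ v, N.graph.dist r v ≤ n := by
      intro v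
      obtain ⟨p, hp, hpd⟩ := N.connected.exists_path_of_dist r v
      rw [← hpd]
      exact hp.length_lt.le
    -- By this round every local clock has completed `n * X` periods, since the start signal arrives
    -- after at most `n` rounds.
    set t₁ := T + 1 + n + (2 * k + 1) * (n * X) with ht₁
    have hst : ∀ v, ∀ t, t₁ ≤ t → n * X ≤ (t - (T + 1 + N.graph.dist r v)) / (2 * k + 1) := by
      intro v t ht
      rw [Nat.le_div_iff_mul_le (by omega), mul_comm]
      have := hdist v
      omega
    have hstable : ∀ t, t₁ + (3 * k + 1) ≤ t → ∀ v,
        (st k φ N r (t + 1) v).know = (st k φ N r t v).know :=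
      fun t ht v => h.know_stable (by omega) (fun v => hst v t₁ le_rfl) ht v
    -- Machine tables can only grow; since the answers are monotone in time, nothing outdated
    -- remains in them.
    have htab : ∀ t v, ⋃ i ≤ t, A.tab (A.run N r i v) = (st k φ N r t v).answers := by
      intro t v
      refine Set.Subset.antisymm (Set.iUnion₂_subset fun i hi => answers_mono hi v) ?_
      exact Set.subset_biUnion_of_mem (u := fun i => A.tab (A.run N r i v)) (le_refl t)
    refine ⟨t₁ + (3 * k + 1), ?_, ?_, ?_⟩
    · have h1 : t₁ + (3 * k + 1) ≤ B * n := by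
        have e1 : (2 * k + 1) * (n * X) = (2 * k + 1) * X * n := by ring
        have e2 : (3 * k + 1) ≤ (3 * k + 1) * n := Nat.le_mul_of_pos_right _ hn1
        rw [hB]
        simp only [add_mul] at hT e1 e2 ⊢
        simp only [add_mul] at ht₁
        omega
      exact h1.trans (Nat.mul_le_mul_right n (by omega))
    · intro t ht v
      have hs := hstable t ht v
      constructor
      · intro p
        -- A message would need a changed exposed value, but status, color, signal and knowledge are
        -- all final.
        by_contra hp
        refine hsend t v p hp ?_
        change (st k φ N r t v).expose p = (st k φ N r (t + 1) v).expose p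
        have e1 : (st k φ N r t v).status = .done := h.stat_eq (by omega) v
        have e2 : (st k φ N r (t + 1) v).status = .done := h.stat_eq (by omega) v
        have e3 := h.col_eq (t := t) (by omega) v
        have e4 := h.col_eq (t := t + 1) (by omega) v
        have := hdist v
        have e5 := (h.go_iff t v).2 (by omega)
        have e6 := (h.go_iff (t + 1) v).2 (by omega)
        simp only [NodeState.expose, e1, e2, e3, e4, e5, e6, hs]
      · rw [hpre, hpost, htab, htab]
        unfold NodeState.answers
        rw [hs]
    · intro v
      have := h.holds_answers (t := t₁ + (3 * k + 1)) (by omega) v (E.pre _ v)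
        ((hpre _ v).trans (htab _ v))
      rwa [stage_eq_fixpoint h.ncard_stage_le (hst v _ (by omega))] at this
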